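/- Let $N\in\mathbb N$, let $X\subset\mathbb R^N$ be compact, let $\mu$ be a Borel probability measure on $X$ and let $T\colon X\to X$ be Lipschitz. Notation. Let $\mathrm{Lip}(X)$ be the Banach space of Lipschitz functions $h\colon X\to\mathbb R$ with the norm $\|h\|=\sup_{x\in X}|h(x)|+\sup_{x\ne y}\frac{|h(x)-h(y)|}{\|x-y\|}$. A set $\mathcal S\subset \mathrm{Lip}(X)$ is called prevalent if it contains a Borel set $\mathcal B$ for which there is a Borel measure $\nu$ on $\mathrm{Lip}(X)$, positive and finite on some compact set, such that for every $v\in \mathrm{Lip}(X)$ one has $v+e\in\mathcal B$ for $\nu$-almost every $e$. Let $N(X,\delta)$ be the minimal number of balls of diameter at most $\delta$ needed to cover $X$, and set $$\underline D=\liminf_{\delta\to0}\frac{\log N(X,\delta)}{-\log\delta},\qquad \overline D=\limsup_{\delta\to0}\frac{\log N(X,\delta)}{-\log\delta}.$$ For $h\in\mathrm{Lip}(X)$ and $k\in\mathbb N$ let $\phi(x)=(h(x),h(Tx),\dots,h(T^{k-1}x))\in\mathbb R^k$ be the $k$-delay coordinate map. For $\varepsilon>0$ and $y\in\mathbb R^k$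 let $B(y,\varepsilon)$ be the open Euclidean ball; whenever $\mu(\phi^{-1}(B(y,\varepsilon)))>0$, put $$\chi_\varepsilon(y)=\frac1{\mu(\phi^{-1}(B(y,\varepsilon)))}\int_{\phi^{-1}(B(y,\varepsilon))}\phi\circ T\,d\mu,$$ $$\sigma_\varepsilon(y)=\Big(\frac1{\mu(\phi^{-1}(B(y,\varepsilon)))}\int_{\phi^{-1}(B(y,\varepsilon))}\|\phi(Tx)-\chi_\varepsilon(y)\|^2\,d\mu(x)\Big)^{1/2}.$$ In the sets below only those $x$ are meant for which $\sigma_\varepsilon(\phi(x))$ is defined. Theorem. There is a prevalent set $\mathcal S\subset\mathrm{Lip}(X)$ such that for every $h\in\mathcal S$, every $k\in\mathbb N$ and all $\delta,\theta>0$ there exist $C,\varepsilon_0>0$ such that for every $0<\varepsilon<\varepsilon_0$ the following hold. (i) If $k>\overline D$, then $$\mu\big(\{x\in X:\sigma_\varepsilon(\phi(x))>\delta\}\big)\le C\,\varepsilon^{\,k-\overline D-\theta}.$$ (ii) If $k>2\underline D$ or $\phi$ is injective, then $$\{x\in X:\sigma_\varepsilon(\phi(x))>\delta\}=\emptyset.$$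 -/

import Mathlib

open Set Filter Topology MeasureTheory
open scoped NNReal ENNReal

noncomputable section

/-! ### The Banach space of Lipschitz observables -/

/-- The real vector space of Lipschitz functions `X → ℝ`, as a subspace of all functions. -/
def lipSubmodule (X : Type*) [MetricSpace X] : Submodule ℝ (X → ℝ) where
  carrier := {h | ∃ C : ℝ≥0, LipschitzWith C h}
  add_mem' := by
    rintro f g ⟨C, hf⟩ ⟨D, hg⟩
    exact ⟨C + D, hf.add hg⟩
  zero_mem' := ⟨0, LipschitzWith.const 0⟩
  smul_mem' := by
    rintro c f ⟨C, hf⟩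
    refine ⟨‖c‖₊ * C, LipschitzWith.of_dist_le_mul fun x y => ?_⟩
    have h1 := hf.dist_le_mul x y
    simp only [Pi.smul_apply, dist_smul₀, NNReal.coe_mul, coe_nnnorm, mul_assoc]
    exact mul_le_mul_of_nonneg_left h1 (norm_nonneg c)

/-- `Lip(X)`: the type of Lipschitz observables `h : X → ℝ`. (A type synonym, so that it carries
the Lipschitz norm below and not the topology of pointwise convergence.) -/
def LipObs (X : Type*) [MetricSpace X] : Type _ := lipSubmodule X

namespace LipObs

variable {X : Type*} [MetricSpace X]

instance : AddCommGroup (LipObs X) := inferInstanceAs (AddCommGroup (lipSubmodule X))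

instance : Module ℝ (LipObs X) := inferInstanceAs (Module ℝ (lipSubmodule X))

instance : FunLike (LipObs X) X ℝ where
  coe h := Subtype.val (p := fun f : X → ℝ => f ∈ lipSubmodule X) h
  coe_injective := Subtype.val_injective

theorem lipschitz (h : LipObs X) : ∃ C : ℝ≥0, LipschitzWith C h := h.2

theorem add_apply (f g : LipObs X) (x : X) : (f + g) x = f x + g x := rfl

theorem neg_apply (f : LipObs X) (x : X) : (-f) x = -(f x) := rfl

theorem sub_apply (f g : LipObs X) (x : X) : (f - g) x = f x - g x := rfl

theorem zero_apply (x : X) : (0 : LipObs X) x = 0 := rfl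

theorem smul_apply (c : ℝ) (f : LipObs X) (x : X) : (c • f) x = c * f x := rfl

/-- `sup_{x} |h(x)|`. -/
def supNorm (h : LipObs X) : ℝ := ⨆ x : X, |h x|

/-- `sup_{x ≠ y} |h(x) - h(y)| / ‖x - y‖` (pairs with `x = y` contribute `0 / 0 = 0`). -/
def lipSeminorm (h : LipObs X) : ℝ := ⨆ p : X × X, |h p.1 - h p.2| / dist p.1 p.2

theorem bdd_sup [BoundedSpace X] (h : LipObs X) : BddAbove (range fun x : X => |h x|) := by
  obtain ⟨C, hC⟩ := h.lipschitz
  rcases isEmpty_or_nonempty X with hX | ⟨⟨x₀⟩⟩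
  · simp
  refine ⟨|h x₀| + C * Metric.diam (univ : Set X), ?_⟩
  rintro _ ⟨x, rfl⟩
  have h1 := hC.dist_le_mul x x₀
  have h2 : dist x x₀ ≤ Metric.diam (univ : Set X) :=
    Metric.dist_le_diam_of_mem (Bornology.isBounded_univ.2 inferInstance) (mem_univ _) (mem_univ _)
  have h3 : |h x| - |h x₀| ≤ |h x - h x₀| := abs_sub_abs_le_abs_sub _ _
  rw [Real.dist_eq] at h1
  have h4 : (C : ℝ) * dist x x₀ ≤ C * Metric.diam (univ : Set X) :=
    mul_le_mul_of_nonneg_left h2 C.2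
  have h5 : |h x - h x₀| ≤ C * dist x x₀ := h1
  show |h x| ≤ _
  linarith

theorem bdd_lip (h : LipObs X) :
    BddAbove (range fun p : X × X => |h p.1 - h p.2| / dist p.1 p.2) := by
  obtain ⟨C, hC⟩ := h.lipschitz
  refine ⟨C, ?_⟩
  rintro _ ⟨p, rfl⟩
  have h1 := hC.dist_le_mul p.1 p.2
  rw [Real.dist_eq] at h1
  exact div_le_of_le_mul₀ dist_nonneg C.2 h1

theorem abs_le_supNorm [BoundedSpace X] (h : LipObs X) (x : X) : |h x| ≤ supNorm h :=
  le_ciSup (bdd_sup h) x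

theorem div_le_lipSeminorm (h : LipObs X) (x y : X) :
    |h x - h y| / dist x y ≤ lipSeminorm h :=
  le_ciSup (bdd_lip h) (x, y)

theorem supNorm_nonneg (h : LipObs X) : 0 ≤ supNorm h :=
  Real.iSup_nonneg fun _ => abs_nonneg _

theorem lipSeminorm_nonneg (h : LipObs X) : 0 ≤ lipSeminorm h :=
  Real.iSup_nonneg fun _ => div_nonneg (abs_nonneg _) dist_nonneg

theorem supNorm_le {h : LipObs X} {a : ℝ} (ha : 0 ≤ a) (H : ∀ x, |h x| ≤ a) : supNorm h ≤ a :=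
  Real.iSup_le H ha

theorem lipSeminorm_le {h : LipObs X} {a : ℝ} (ha : 0 ≤ a)
    (H : ∀ x y, |h x - h y| / dist x y ≤ a) : lipSeminorm h ≤ a :=
  Real.iSup_le (fun p => H p.1 p.2) ha

/-- On a bounded metric space `Lip(X)` is normed by
`‖h‖ = sup_x |h(x)| + sup_{x ≠ y} |h(x) - h(y)| / ‖x - y‖`. -/
instance [BoundedSpace X] : NormedAddCommGroup (LipObs X) :=
  AddGroupNorm.toNormedAddCommGroup
    { toFun := fun h => supNorm h + lipSeminorm h
      map_zero' := by
        simp [supNorm, lipSeminorm, zero_apply]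
      add_le' := fun f g => by
        have h1 : supNorm (f + g) ≤ supNorm f + supNorm g :=
          supNorm_le (add_nonneg (supNorm_nonneg f) (supNorm_nonneg g)) fun x => by
            rw [add_apply]
            exact (abs_add_le _ _).trans (add_le_add (abs_le_supNorm f x) (abs_le_supNorm g x))
        have h2 : lipSeminorm (f + g) ≤ lipSeminorm f + lipSeminorm g :=
          lipSeminorm_le (add_nonneg (lipSeminorm_nonneg f) (lipSeminorm_nonneg g)) fun x y => by
            rw [add_apply, add_apply]
            refine le_trans ?_
              (add_le_add (div_le_lipSeminorm f x y) (div_le_lipSeminorm g x y))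
            rw [← add_div]
            refine div_le_div_of_nonneg_right ?_ dist_nonneg
            rw [add_sub_add_comm]
            exact abs_add_le _ _
        linarith
      neg' := fun f => by
        simp only [supNorm, lipSeminorm, neg_apply, abs_neg, ← neg_sub']
      eq_zero_of_map_eq_zero' := fun f hf => by
        have h1 : supNorm f = 0 := by
          have := supNorm_nonneg f
          have := lipSeminorm_nonneg f
          linarith
        refine DFunLike.ext _ _ fun x => ?_
        have h2 := abs_le_supNorm f x
        rw [h1] at h2
        exact abs_nonpos_iff.1 h2 }

theorem norm_def [BoundedSpace X] (h : LipObs X) : ‖h‖ = supNorm h + lipSeminorm h := rfl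

instance [BoundedSpace X] : NormedSpace ℝ (LipObs X) where
  norm_smul_le c f := by
    rw [norm_def, norm_def, mul_add]
    refine add_le_add
      (supNorm_le (mul_nonneg (norm_nonneg c) (supNorm_nonneg f)) fun x => ?_)
      (lipSeminorm_le (mul_nonneg (norm_nonneg c) (lipSeminorm_nonneg f)) fun x y => ?_)
    · rw [smul_apply, abs_mul]
      exact mul_le_mul_of_nonneg_left (abs_le_supNorm f x) (norm_nonneg c)
    · rw [smul_apply, smul_apply, ← mul_sub, abs_mul, mul_div_assoc]
      exact mul_le_mul_of_nonneg_left (div_le_lipSeminorm f x y) (norm_nonneg c)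

theorem abs_apply_le_norm [BoundedSpace X] (h : LipObs X) (x : X) : |h x| ≤ ‖h‖ := by
  have h1 := abs_le_supNorm h x
  have h2 := lipSeminorm_nonneg h
  rw [norm_def]
  linarith

theorem div_le_norm [BoundedSpace X] (h : LipObs X) (x y : X) :
    |h x - h y| / dist x y ≤ ‖h‖ := by
  have h1 := div_le_lipSeminorm h x y
  have h2 := supNorm_nonneg h
  rw [norm_def]
  linarith

instance [BoundedSpace X] : CompleteSpace (LipObs X) := by
  refine Metric.complete_of_cauchySeq_tendsto fun u hu => ?_
  have hpt : ∀ x, ∃ a, Tendsto (fun n => u n x) atTop (𝓝 a) := fun x => by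
    refine cauchySeq_tendsto_of_complete (Metric.cauchySeq_iff'.2 fun ε hε => ?_)
    obtain ⟨n₀, hn₀⟩ := Metric.cauchySeq_iff'.1 hu ε hε
    refine ⟨n₀, fun n hn => lt_of_le_of_lt ?_ (hn₀ n hn)⟩
    rw [dist_eq_norm (u n), Real.dist_eq]
    exact abs_apply_le_norm (u n - u n₀) x
  choose g hg using hpt
  obtain ⟨R, -, hR⟩ := cauchySeq_bdd hu
  have hgL : LipschitzWith (‖u 0‖ + R).toNNReal g := by
    refine LipschitzWith.of_dist_le_mul fun x y => ?_
    refine le_of_tendsto ((hg x).dist (hg y)) (Eventually.of_forall fun n => ?_)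
    have h1 : ‖u n‖ ≤ ‖u 0‖ + R := by
      have h2 := (hR n 0).le
      rw [dist_eq_norm] at h2
      have h3 := norm_sub_norm_le (u n) (u 0)
      linarith
    have h4 := (div_le_norm (u n) x y).trans (h1.trans (Real.le_coe_toNNReal _))
    rw [Real.dist_eq]
    rcases eq_or_ne x y with rfl | hxy
    · simp
    · exact (div_le_iff₀ (dist_pos.2 hxy)).1 h4
  refine ⟨⟨g, _, hgL⟩, Metric.tendsto_atTop.2 fun ε hε => ?_⟩
  obtain ⟨n₀, hn₀⟩ := Metric.cauchySeq_iff.1 hu (ε / 4) (by linarith)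
  refine ⟨n₀, fun n hn => ?_⟩
  set G : LipObs X := ⟨g, _, hgL⟩ with hG
  have hGx : ∀ x, G x = g x := fun _ => rfl
  have h1 : supNorm (u n - G) ≤ ε / 4 := supNorm_le (by linarith) fun x => by
    rw [sub_apply, hGx]
    refine le_of_tendsto ((tendsto_const_nhds.sub (hg x)).abs)
      (eventually_atTop.2 ⟨n₀, fun m hm => ?_⟩)
    have h2 := (hn₀ n hn m hm).le
    rw [dist_eq_norm] at h2
    exact (abs_apply_le_norm (u n - u m) x).trans h2
  have h3 : lipSeminorm (u n - G) ≤ ε / 4 := lipSeminorm_le (by linarith) fun x y => by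
    rw [sub_apply, sub_apply, hGx, hGx]
    refine le_of_tendsto ((((tendsto_const_nhds.sub (hg x)).sub
      (tendsto_const_nhds.sub (hg y))).abs).div_const _)
      (eventually_atTop.2 ⟨n₀, fun m hm => ?_⟩)
    have h2 := (hn₀ n hn m hm).le
    rw [dist_eq_norm] at h2
    exact (div_le_norm (u n - u m) x y).trans h2
  rw [dist_eq_norm, norm_def]
  linarith

instance [BoundedSpace X] : MeasurableSpace (LipObs X) := borel _

instance [BoundedSpace X] : BorelSpace (LipObs X) := ⟨rfl⟩

end LipObs

/-! ### Prevalence -/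

/-- A subset `S` of a Banach space `V` is prevalent if it contains a Borel set `B` for which there
is a Borel measure `ν` on `V`, positive and finite on some compact set, such that for every `v`
we have `v + e ∈ B` for `ν`-almost every `e`. -/
def IsPrevalent {V : Type*} [NormedAddCommGroup V] [NormedSpace ℝ V] [CompleteSpace V]
    [MeasurableSpace V] [BorelSpace V] (S : Set V) : Prop :=
  ∃ B : Set V, B ⊆ S ∧ MeasurableSet B ∧
    ∃ ν : Measure V, (∃ K : Set V, IsCompact K ∧ 0 < ν K ∧ ν K < ∞) ∧
      ∀ v : V, ∀ᵐ e ∂ν, v + e ∈ B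

/-! ### Box-counting dimensions -/

/-- `N(X, δ)`: the minimal number of balls of diameter at most `δ` in `ℝᴺ` needed to cover the
bounded set `X`. -/
def coveringNum {N : ℕ} (X : Set (EuclideanSpace ℝ (Fin N))) (δ : ℝ) : ℕ :=
  sInf {n : ℕ | ∃ (c : Fin n → EuclideanSpace ℝ (Fin N)) (r : Fin n → ℝ),
    (∀ i, Metric.diam (Metric.ball (c i) (r i)) ≤ δ) ∧ X ⊆ ⋃ i, Metric.ball (c i) (r i)}

/-- The lower box-counting dimension of a bounded set,
`liminf_{δ → 0} log N(X, δ) / (- log δ)`. The lower limit is taken in the extended reals, where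
it needs no boundedness. -/
def lowerBoxDim {N : ℕ} (X : Set (EuclideanSpace ℝ (Fin N))) : EReal :=
  liminf (fun δ : ℝ => ((Real.log (coveringNum X δ) / (-Real.log δ) : ℝ) : EReal)) (𝓝[>] 0)

/-- The upper box-counting dimension of a bounded set,
`limsup_{δ → 0} log N(X, δ) / (- log δ)`, taken in the extended reals. -/
def upperBoxDim {N : ℕ} (X : Set (EuclideanSpace ℝ (Fin N))) : EReal :=
  limsup (fun δ : ℝ => ((Real.log (coveringNum X δ) / (-Real.log δ) : ℝ) : EReal)) (𝓝[>] 0)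

/-! ### Delay coordinate maps and the prediction error -/

/-- The `k`-delay coordinate map `φ(x) = (h(x), h(Tx), …, h(T^{k-1}x))`, with values in `ℝᵏ`
with its Euclidean norm. -/
def delayMap {X : Type*} (T : X → X) (h : X → ℝ) (k : ℕ) (x : X) : EuclideanSpace ℝ (Fin k) :=
  WithLp.toLp 2 fun i : Fin k => h (T^[i] x)

/-- `χ_ε(y)`: the mean of `φ ∘ T` over `φ⁻¹(B(y, ε))`. -/
def predMean {X : Type*} [MeasurableSpace X] (μ : Measure X) (T : X → X) (h : X → ℝ) (k : ℕ)
    (ε : ℝ) (y : EuclideanSpace ℝ (Fin k)) : EuclideanSpace ℝ (Fin k) :=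
  (μ.real (delayMap T h k ⁻¹' Metric.ball y ε))⁻¹ •
    ∫ x in delayMap T h k ⁻¹' Metric.ball y ε, delayMap T h k (T x) ∂μ

/-- `σ_ε(y)`: the standard deviation of `φ ∘ T` over `φ⁻¹(B(y, ε))`. It is meaningful only when
`μ (φ⁻¹(B(y, ε))) > 0`; otherwise the value here is `0`, so that such a `y` never belongs to a set
`{σ_ε > δ}` with `δ > 0`. -/
def predError {X : Type*} [MeasurableSpace X] (μ : Measure X) (T : X → X) (h : X → ℝ) (k : ℕ)
    (ε : ℝ) (y : EuclideanSpace ℝ (Fin k)) : ℝ :=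
  Real.sqrt ((μ.real (delayMap T h k ⁻¹' Metric.ball y ε))⁻¹ *
    ∫ x in delayMap T h k ⁻¹' Metric.ball y ε,
      ‖delayMap T h k (T x) - predMean μ T h k ε y‖ ^ 2 ∂μ)

end

/-! A large prediction error at `x` produces an ambiguous partner `y`: `φ(x)` and `φ(y)` are
`ε`-close while `h(T^k x)` and `h(T^k y)` differ by at least `δ/(2(k+1))`. Otherwise `φ ∘ T` would
stay within `δ/2` of `φ(Tx)` on the whole fibre, because `φ(Ty)` is the shift of `φ(y)` with one new
coordinate (`mem_ambiguousSet_of_lt_predError`). So it suffices to bound the set of ambiguous points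
for typical `h`.

The observable is perturbed by a random series `∑ αₙ wₙ` with independent uniform coefficients,
where the `wₙ` separate finitely supported signed measures. The core estimate is that a fixed pair
is ambiguous with probability at most `C ε^k`, uniformly over pairs
(`exists_coeffLaw_ambiguousPair_le`). Put `m_a = δ_{T^a x} - δ_{T^a y}`. If `m_0, …, m_{k-1}` are
independent, some `k` probes give an invertible matrix, and `k` closeness conditions cost `ε^k`. If
they are dependent, pushing forward by `T` shows that `m_k` lies in their span, so closeness of `k`
observations forces closeness of the next one and no ambiguity is possible for small `ε`. This
dichotomy avoids any assumption on periodic points of `T`. Both cases persist near the pair, and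
compactness of `X × X` makes the constants uniform.

An `ε`-net then yields probability of order `N(X,ε) ε^k` that a given point is ambiguous, and
`N(X,ε)² ε^k` that any point is. Fubini, Markov and Borel–Cantelli along `ε = 2⁻ⁿ` turn the first
into (i). The second tends to `0` along some sequence of scales when `k > 2D̲`, which gives (ii) by
monotonicity in `ε`. For injective `φ`, (ii) is plain compactness. -/

/-! ### Linear algebra -/

/-- If the first `k` vectors of an orbit of a linear map are linearly dependent, then the next
vector lies in their span. -/
theorem orbit_mem_span_of_not_linearIndependent {V : Type*} [AddCommGroup V] [Module ℝ V]
    (A : V →ₗ[ℝ] V) (v : ℕ → V) (hv : ∀ a, A (v a) = v (a + 1)) (k : ℕ)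
    (h : ¬ LinearIndependent ℝ fun a : Fin k => v a) :
    v k ∈ Submodule.span ℝ (range fun a : Fin k => v a) := by
  induction k with
  | zero => exact absurd linearIndependent_empty_type h
  | succ k ih =>
    have h1 : v k ∈ Submodule.span ℝ (range fun a : Fin k => v a) := by
      rw [linearIndependent_finSucc', not_and_or, not_not] at h
      exact h.elim ih id
    -- `A` shifts the orbit, so a relation expressing `v k` through its predecessors becomes one for
    -- `v (k + 1)`.
    have h2 := Submodule.mem_map_of_mem (f := A) h1
    rw [hv, Submodule.map_span] at h2
    refine Submodule.span_mono ?_ h2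
    rintro _ ⟨_, ⟨a, rfl⟩, rfl⟩
    exact ⟨a.succ, by simp [hv]⟩

/-- Either finitely many of the vectors `u i ∈ ℝᵏ` form a basis, or some nonzero linear functional
vanishes on all of them. -/
theorem exists_det_ne_zero_or_exists_annihilator {ι : Type*} {k : ℕ} (u : ι → Fin k → ℝ) :
    (∃ j : Fin k → ι, Function.Injective j ∧ (Matrix.of fun a b => u (j b) a).det ≠ 0) ∨
      ∃ c : Fin k → ℝ, c ≠ 0 ∧ ∀ i, ∑ a, c a * u i a = 0 := by
  by_cases hs : Submodule.span ℝ (range u) = ⊤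
  · left
    obtain ⟨κ, a, ha, hspan, hli⟩ := exists_linearIndependent' ℝ u
    rw [hs] at hspan
    let b := Module.Basis.mk hli hspan.ge
    let e : Fin k ≃ κ := (Pi.basisFun ℝ (Fin k)).indexEquiv b
    refine ⟨a ∘ e, ha.comp e.injective, ?_⟩
    have h1 : LinearIndependent ℝ (Matrix.of fun b => u (a (e b))).row :=
      hli.comp e e.injective
    rw [Matrix.linearIndependent_rows_iff_isUnit, Matrix.isUnit_iff_isUnit_det,
      ← Matrix.det_transpose] at h1
    exact h1.ne_zero
  · right
    obtain ⟨f, hf, hle⟩ := Submodule.exists_le_ker_of_lt_top _ (lt_top_iff_ne_top.2 hs)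
    have hsum : ∀ x, f x = ∑ a, x a * f fun j => if a = j then 1 else 0 := fun x => by
      conv_lhs => rw [LinearMap.pi_apply_eq_sum_univ f x]
      simp only [smul_eq_mul]
    refine ⟨fun a => f fun j => if a = j then 1 else 0, fun h0 => hf ?_, fun i => ?_⟩
    · refine LinearMap.ext fun x => ?_
      rw [hsum, LinearMap.zero_apply]
      exact Finset.sum_eq_zero fun a _ => by rw [show _ = _ from congrFun h0 a]; simp
    · have h1 : f (u i) = 0 := hle (Submodule.subset_span ⟨i, rfl⟩)
      rw [hsum] at h1
      exact (Finset.sum_congr rfl fun a _ => mul_comm _ _).trans h1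

/-! ### Random coordinates -/

theorem volume_map_unitInterval_coe_le {k : ℕ} (s : Set (Fin k → ℝ)) (hs : MeasurableSet s) :
    Measure.pi (fun _ : Fin k => (volume : Measure unitInterval))
      ((fun β i => (β i : ℝ)) ⁻¹' s) ≤ volume s := by
  have h0 : (volume : Measure unitInterval).map (Subtype.val : unitInterval → ℝ) =
      volume.restrict unitInterval :=
    map_comap_subtype_coe measurableSet_Icc volume
  have h1 : (Measure.pi fun _ : Fin k => (volume : Measure unitInterval)).map
      (fun β i => (β i : ℝ)) = volume.restrict (univ.pi fun _ => unitInterval) := by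
    rw [Measure.pi_map_pi (fun i => measurable_subtype_coe.aemeasurable), volume_pi,
      Measure.restrict_pi_pi, h0]
  have h2 : Measurable fun (β : Fin k → unitInterval) i => (β i : ℝ) := by fun_prop
  rw [← Measure.map_apply h2 hs, h1]
  exact Measure.restrict_apply_le _ _

/-- Small ball estimate for an invertible affine function of a uniform point of the cube. -/
theorem pi_unitInterval_affine_le {k : ℕ} (A : Matrix (Fin k) (Fin k) ℝ) (hA : A.det ≠ 0)
    (b : Fin k → ℝ) {ε : ℝ} (hε : 0 ≤ ε) :
    Measure.pi (fun _ : Fin k => (volume : Measure unitInterval))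
      {β | ∀ a, |b a + ∑ i, A a i * (β i : ℝ)| ≤ ε} ≤
        ENNReal.ofReal (|A.det|⁻¹ * (2 * ε) ^ k) := by
  have hdet : LinearMap.det (Matrix.toLin' A) = A.det := LinearMap.det_toLin' A
  have h1 := Measure.addHaar_preimage_linearMap (volume : Measure (Fin k → ℝ))
    (hdet.symm ▸ hA) (Metric.closedBall (-b) ε)
  have h2 : MeasurableSet (Matrix.toLin' A ⁻¹' Metric.closedBall (-b) ε) :=
    (Metric.isClosed_closedBall.preimage
      (LinearMap.continuous_of_finiteDimensional _)).measurableSet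
  have h3 := volume_map_unitInterval_coe_le _ h2
  rw [h1, Real.volume_pi_closedBall _ hε, hdet, abs_inv, Fintype.card_fin,
    ← ENNReal.ofReal_mul (by positivity)] at h3
  refine le_trans (measure_mono fun β hβ => ?_) h3
  simp only [mem_preimage, Metric.mem_closedBall, dist_pi_le_iff hε]
  intro a
  have := hβ a
  rw [Real.dist_eq, Matrix.toLin'_apply, Matrix.mulVec, dotProduct, Pi.neg_apply, sub_neg_eq_add,
    add_comm]
  exact this

/-- Resampling finitely many coordinates does not change the law of an i.i.d. family. -/
theorem map_extend_infinitePi {ι κ Ω : Type*} [Fintype κ] [MeasurableSpace Ω] (P : Measure Ω)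
    [IsProbabilityMeasure P] {j : κ → ι} (hj : Function.Injective j) :
    Measurable (fun p : (ι → Ω) × (κ → Ω) => Function.extend j p.2 p.1) ∧
    ((Measure.infinitePi fun _ : ι => P).prod (Measure.pi fun _ : κ => P)).map
      (fun p => Function.extend j p.2 p.1) = Measure.infinitePi fun _ : ι => P := by
  classical
  have hmeas : Measurable (fun p : (ι → Ω) × (κ → Ω) => Function.extend j p.2 p.1) := by
    refine measurable_pi_iff.2 fun i => ?_
    by_cases hi : ∃ b, j b = i
    · obtain ⟨b, rfl⟩ := hi
      simp only [hj.extend_apply]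
      fun_prop
    · simp only [Function.extend_apply' _ _ _ hi]
      fun_prop
  refine ⟨hmeas, Measure.eq_infinitePi _ fun s t ht => ?_⟩
  rw [Measure.map_apply hmeas (.pi s.countable_toSet fun _ _ => ht _)]
  -- The preimage of a box is a product of boxes: indices outside the range of `j` constrain the old
  -- sample, those inside it the new one.
  have h1 : (fun p : (ι → Ω) × (κ → Ω) => Function.extend j p.2 p.1) ⁻¹' (s : Set ι).pi t =
      (((s.filter fun i => ¬ ∃ b, j b = i : Finset ι) : Set ι).pi t) ×ˢ
        (univ.pi fun b => if j b ∈ s then t (j b) else univ) := by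
    ext ⟨α, β⟩
    rw [mem_preimage, mem_prod, Set.mem_pi, Set.mem_pi, mem_univ_pi]
    simp only [Finset.mem_coe, Finset.mem_filter]
    constructor
    · refine fun H => ⟨fun i hi => ?_, fun b => ?_⟩
      · simpa [Function.extend_apply' _ _ _ hi.2] using H i hi.1
      · split_ifs with hb
        · simpa [hj.extend_apply] using H _ hb
        · trivial
    · rintro ⟨H1, H2⟩ i hi
      by_cases h : ∃ b, j b = i
      · obtain ⟨b, rfl⟩ := h
        have := H2 b
        rw [if_pos hi] at this
        simpa [hj.extend_apply] using this
      · simpa [Function.extend_apply' _ _ _ h] using H1 i ⟨hi, h⟩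
  rw [h1, Measure.prod_prod, Measure.infinitePi_pi _ fun i _ => ht i, Measure.pi_pi,
    ← Finset.prod_filter_mul_prod_filter_not s fun i => ¬ ∃ b, j b = i]
  congr 1
  have h2 : ∀ b, P (if j b ∈ s then t (j b) else univ) = if j b ∈ s then P (t (j b)) else 1 := by
    intro b
    split_ifs <;> simp
  simp_rw [h2]
  rw [← Finset.prod_filter]
  refine Finset.prod_bij (fun b _ => j b) ?_ ?_ ?_ ?_
  · intro b hb
    simpa using hb
  · intro b _ b' _ h
    exact hj h
  · intro i hi
    simp only [not_not, Finset.mem_filter] at hi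
    obtain ⟨hi, b, rfl⟩ := hi
    exact ⟨b, by simpa using hi, rfl⟩
  · simp

/-- Conditioning on the other coordinates: only the finitely many indices in the range of `j` need
be random, so a bound uniform in the frozen ones integrates to a bound on the whole law. -/
theorem infinitePi_le_of_extend_le {ι κ Ω : Type*} [Fintype κ] [MeasurableSpace Ω] (P : Measure Ω)
    [IsProbabilityMeasure P] {j : κ → ι} (hj : Function.Injective j) {s : Set (ι → Ω)}
    (hs : MeasurableSet s) {c : ℝ≥0∞}
    (h : ∀ α, Measure.pi (fun _ : κ => P) {β | Function.extend j β α ∈ s} ≤ c) :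
    Measure.infinitePi (fun _ : ι => P) s ≤ c := by
  obtain ⟨hm, he⟩ := map_extend_infinitePi P hj
  rw [← he, Measure.map_apply hm hs, Measure.prod_apply (hm hs)]
  refine (lintegral_mono h).trans ?_
  simp

noncomputable section

/-! ### The probe measure -/

section Probe

variable {X : Type*} [MetricSpace X]

/-- A truncated cone function. -/
def coneObs (p : X) (r : ℝ) : LipObs X :=
  ⟨fun z => max (r - dist z p) 0, 1, by
    have h := ((LipschitzWith.const (α := X) r).sub (LipschitzWith.dist_left p)).max_const 0
    simpa using h⟩

theorem coneObs_apply (p z : X) (r : ℝ) : coneObs p r z = max (r - dist z p) 0 := rfl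

/-- A countable family of Lipschitz functions separating finitely supported measures. -/
theorem exists_separating_seq [CompactSpace X] [Nonempty X] :
    ∃ g : ℕ → LipObs X, ∀ m : X →₀ ℝ,
      (∀ n, Finsupp.linearCombination ℝ (g n) m = 0) → m = 0 := by
  classical
  refine ⟨fun n => coneObs (TopologicalSpace.denseSeq X n.unpair.1) (1 / (n.unpair.2 + 1)),
    fun m hm => ?_⟩
  by_contra hne
  obtain ⟨z, hz⟩ := Finsupp.support_nonempty_iff.2 hne
  -- A cone of radius below `r / 2`, centred within that radius of `z`, is positive at `z` and
  -- vanishes on the rest of the support.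
  obtain ⟨r, hr, hball⟩ := Metric.isOpen_iff.1
    ((m.support.erase z).finite_toSet.isClosed.isOpen_compl) z (by simp)
  obtain ⟨n, hn⟩ := exists_nat_one_div_lt (half_pos hr)
  have hn0 : (0 : ℝ) < 1 / (n + 1) := by positivity
  obtain ⟨i, hi⟩ := Metric.denseRange_iff.1 (TopologicalSpace.denseRange_denseSeq X) z _ hn0
  have h1 := hm (Nat.pair i n)
  simp only [Nat.unpair_pair] at h1
  rw [Finsupp.linearCombination_apply, Finsupp.sum, Finset.sum_eq_single z] at h1
  · rw [smul_eq_mul, coneObs_apply, max_eq_left (by linarith)] at h1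
    have h2 : m z ≠ 0 := by simpa using hz
    have h3 : (1 : ℝ) / (n + 1) - dist z (TopologicalSpace.denseSeq X i) ≠ 0 := by
      have : (0 : ℝ) < 1 / (n + 1) - dist z (TopologicalSpace.denseSeq X i) := by linarith
      exact this.ne'
    exact mul_ne_zero h2 h3 h1
  · intro y hy hyz
    have h2 : r ≤ dist y z := by
      by_contra hlt
      exact hball (Metric.mem_ball.2 (not_le.1 hlt)) (by simpa [hyz] using hy)
    have h3 := dist_triangle_right y z (TopologicalSpace.denseSeq X i)
    rw [coneObs_apply, max_eq_right (by linarith), smul_zero]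
  · exact fun h => absurd hz h

theorem exists_summable_separating_seq [CompactSpace X] [Nonempty X] :
    ∃ w : ℕ → LipObs X, (Summable fun n => ‖w n‖) ∧ ∀ m : X →₀ ℝ,
      (∀ n, Finsupp.linearCombination ℝ (w n) m = 0) → m = 0 := by
  obtain ⟨g, hg⟩ := exists_separating_seq (X := X)
  have hpos : ∀ n, 0 < (1 / 2 : ℝ) ^ n * (1 + ‖g n‖)⁻¹ := fun n => by positivity
  refine ⟨fun n => ((1 / 2 : ℝ) ^ n * (1 + ‖g n‖)⁻¹) • g n, ?_, fun m hm => hg m fun n => ?_⟩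
  · refine Summable.of_nonneg_of_le (fun n => norm_nonneg _) (fun n => ?_) summable_geometric_two
    rw [norm_smul, Real.norm_of_nonneg (hpos n).le, mul_assoc]
    refine mul_le_of_le_one_right (by positivity) ?_
    rw [inv_mul_le_one₀ (by positivity)]
    linarith
  · have h := hm n
    simp only [Finsupp.linearCombination_apply, Finsupp.sum, LipObs.smul_apply, smul_eq_mul] at h ⊢
    have h2 : ((1 / 2 : ℝ) ^ n * (1 + ‖g n‖)⁻¹) * ∑ x ∈ m.support, m x * g n x = 0 := by
      rw [← h, Finset.mul_sum]
      exact Finset.sum_congr rfl fun x _ => by ring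
    exact (mul_eq_zero.1 h2).resolve_left (hpos n).ne'

variable [CompactSpace X]

/-- The random series `∑ αₙ wₙ`. -/
def probe (w : ℕ → LipObs X) (α : ℕ → unitInterval) : LipObs X := ∑' n, (α n : ℝ) • w n

theorem norm_smul_unitInterval_le (w : LipObs X) (t : unitInterval) : ‖(t : ℝ) • w‖ ≤ ‖w‖ := by
  rw [norm_smul, Real.norm_of_nonneg t.2.1]
  exact mul_le_of_le_one_left (norm_nonneg _) t.2.2

variable {w : ℕ → LipObs X}

theorem summable_probe (hw : Summable fun n => ‖w n‖) (α : ℕ → unitInterval) :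
    Summable fun n => (α n : ℝ) • w n :=
  Summable.of_norm_bounded hw fun _ => norm_smul_unitInterval_le _ _

theorem continuous_probe (hw : Summable fun n => ‖w n‖) : Continuous (probe w) :=
  continuous_tsum (fun _ => by fun_prop) hw fun _ _ => norm_smul_unitInterval_le _ _

theorem norm_probe_le (hw : Summable fun n => ‖w n‖) (α : ℕ → unitInterval) :
    ‖probe w α‖ ≤ ∑' n, ‖w n‖ :=
  tsum_of_norm_bounded hw.hasSum fun _ => norm_smul_unitInterval_le _ _

theorem probe_extend (hw : Summable fun n => ‖w n‖) {k : ℕ} {j : Fin k → ℕ}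
    (hj : Function.Injective j) (α : ℕ → unitInterval) (β : Fin k → unitInterval) :
    probe w (Function.extend j β α) =
      probe w (Function.extend j 0 α) + ∑ b, (β b : ℝ) • w (j b) := by
  classical
  rw [← sub_eq_iff_eq_add', probe, probe,
    ← (summable_probe hw _).tsum_sub (summable_probe hw _),
    tsum_eq_sum (s := Finset.univ.image j), Finset.sum_image fun _ _ _ _ h => hj h]
  · simp [hj.extend_apply]
  · intro n hn
    have : ¬ ∃ b, j b = n := by simpa using hn
    simp [Function.extend_apply' _ _ _ this]

/-- A set is prevalent if it contains a Borel set of full measure along all translates of the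
random series. -/
theorem isPrevalent_of_probe (hw : Summable fun n => ‖w n‖) {S : Set (LipObs X)}
    (hS : MeasurableSet S)
    (h : ∀ v, ∀ᵐ α ∂(Measure.infinitePi fun _ : ℕ => (volume : Measure unitInterval)),
      v + probe w α ∈ S) : IsPrevalent S := by
  have hc := continuous_probe hw
  refine ⟨S, Subset.rfl, hS, (Measure.infinitePi fun _ => volume).map (probe w),
    -- The range is a continuous image of the compact cube `[0,1]^ℕ`, and it carries the full mass
    -- `1`.
    ⟨range (probe w), isCompact_range hc, ?_⟩, fun v => ?_⟩
  · rw [Measure.map_apply hc.measurable (isCompact_range hc).measurableSet]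
    simp
  · rw [ae_map_iff hc.measurable.aemeasurable]
    · exact h v
    · exact (measurable_const_add v) hS

theorem LipObs.continuous_eval : Continuous fun p : LipObs X × X => p.1 p.2 := by
  refine continuous_prod_of_continuous_lipschitzWith _ 1 (fun h => ?_) fun x => ?_
  · obtain ⟨C, hC⟩ := h.lipschitz
    exact hC.continuous
  · refine LipschitzWith.of_dist_le_mul fun h h' => ?_
    rw [NNReal.coe_one, one_mul, dist_eq_norm, dist_eq_norm]
    exact LipObs.abs_apply_le_norm (h - h') x

theorem LipObs.continuous_coe (h : LipObs X) : Continuous h :=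
  LipObs.continuous_eval.comp (Continuous.prodMk_right h)

theorem LipObs.abs_sub_le (h : LipObs X) (x y : X) : |h x - h y| ≤ ‖h‖ * dist x y := by
  rcases eq_or_ne x y with rfl | hxy
  · simp
  · exact (div_le_iff₀ (dist_pos.2 hxy)).1 (LipObs.div_le_norm h x y)

end Probe

end

noncomputable section

/-! ### Pairs with close delay vectors and distant predictions -/

section Ambiguous

variable {X : Type*}

/-- The first `k` observations along the orbits of `x` and `y` are `ε`-close, while the next ones
are `δ`-apart. -/
def AmbiguousPair (T : X → X) (h : X → ℝ) (k : ℕ) (ε δ : ℝ) (x y : X) : Prop :=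
  (∀ a : Fin k, |h (T^[a] x) - h (T^[a] y)| ≤ ε) ∧ δ ≤ |h (T^[k] x) - h (T^[k] y)|

/-- The points belonging to an ambiguous pair. -/
def ambiguousSet (T : X → X) (h : X → ℝ) (k : ℕ) (ε δ : ℝ) : Set X :=
  {x | ∃ y, AmbiguousPair T h k ε δ x y}

theorem AmbiguousPair.mono {T : X → X} {h : X → ℝ} {k : ℕ} {ε ε' δ δ' : ℝ} {x y : X}
    (H : AmbiguousPair T h k ε δ x y) (hε : ε ≤ ε') (hδ : δ' ≤ δ) :
    AmbiguousPair T h k ε' δ' x y :=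
  ⟨fun a => (H.1 a).trans hε, hδ.trans H.2⟩

theorem ambiguousSet_mono {T : X → X} {h : X → ℝ} {k : ℕ} {ε ε' δ δ' : ℝ}
    (hε : ε ≤ ε') (hδ : δ' ≤ δ) : ambiguousSet T h k ε δ ⊆ ambiguousSet T h k ε' δ' :=
  fun _ ⟨y, hy⟩ => ⟨y, hy.mono hε hδ⟩

variable [MetricSpace X] [CompactSpace X]

theorem isClosed_ambiguousPair {T : X → X} (hT : Continuous T) (k : ℕ) (ε δ : ℝ) :
    IsClosed {p : (LipObs X × X) × X | AmbiguousPair T p.1.1 k ε δ p.1.2 p.2} := by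
  have h1 : ∀ a, Continuous fun p : (LipObs X × X) × X =>
      |p.1.1 (T^[a] p.1.2) - p.1.1 (T^[a] p.2)| := fun a => by
    have h2 : Continuous fun p : (LipObs X × X) × X => p.1.1 (T^[a] p.1.2) :=
      LipObs.continuous_eval.comp (continuous_fst.fst.prodMk
        ((hT.iterate a).comp continuous_fst.snd))
    have h3 : Continuous fun p : (LipObs X × X) × X => p.1.1 (T^[a] p.2) :=
      LipObs.continuous_eval.comp (continuous_fst.fst.prodMk
        ((hT.iterate a).comp continuous_snd))
    exact (h2.sub h3).abs
  have h4 : IsClosed {p : (LipObs X × X) × X | ∀ a : Fin k,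
      |p.1.1 (T^[a] p.1.2) - p.1.1 (T^[a] p.2)| ≤ ε} := by
    simp only [ofPred_forall]
    exact isClosed_iInter fun a => isClosed_le (h1 a) continuous_const
  exact h4.inter (isClosed_le continuous_const (h1 k))

/-- The non-strict inequalities make ambiguity a closed relation, and projecting out the compact
factor of `y` keeps it closed. This supplies the joint measurability needed for Fubini. -/
theorem isClosed_ambiguousSet_prod {T : X → X} (hT : Continuous T) (k : ℕ) (ε δ : ℝ) :
    IsClosed {p : LipObs X × X | p.2 ∈ ambiguousSet T p.1 k ε δ} := by
  convert! isClosedMap_fst_of_compactSpace _ (isClosed_ambiguousPair hT k ε δ) using 1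
  ext p
  constructor
  · rintro ⟨y, hy⟩
    exact ⟨(p, y), hy, rfl⟩
  · rintro ⟨⟨p, y⟩, hy, rfl⟩
    exact ⟨y, hy⟩

theorem isClosed_nonempty_ambiguousSet {T : X → X} (hT : Continuous T) (k : ℕ) (ε δ : ℝ) :
    IsClosed {h : LipObs X | (ambiguousSet T h k ε δ).Nonempty} := by
  convert! isClosedMap_fst_of_compactSpace _ (isClosed_ambiguousSet_prod hT k ε δ) using 1
  ext h
  constructor
  · rintro ⟨x, hx⟩
    exact ⟨(h, x), hx, rfl⟩
  · rintro ⟨⟨h, x⟩, hx, rfl⟩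
    exact ⟨x, hx⟩

/-- The law of the coefficients of the random series. -/
abbrev coeffLaw : Measure (ℕ → unitInterval) :=
  Measure.infinitePi fun _ => (volume : Measure unitInterval)

variable {w : ℕ → LipObs X}

theorem continuous_add_probe (hw : Summable fun n => ‖w n‖) (v : LipObs X) :
    Continuous fun α => v + probe w α :=
  continuous_const.add (continuous_probe hw)

theorem coeffLaw_close_le (hw : Summable fun n => ‖w n‖) (T : X → X) (v : LipObs X)
    {k : ℕ} {j : Fin k → ℕ} (hj : Function.Injective j) {x y : X}
    (hdet : (Matrix.of fun a b : Fin k => w (j b) (T^[a] x) - w (j b) (T^[a] y)).det ≠ 0)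
    {ε : ℝ} (hε : 0 ≤ ε) :
    coeffLaw {α | ∀ a : Fin k, |(v + probe w α) (T^[a] x) - (v + probe w α) (T^[a] y)| ≤ ε} ≤
      ENNReal.ofReal (|(Matrix.of fun a b : Fin k =>
        w (j b) (T^[a] x) - w (j b) (T^[a] y)).det|⁻¹ * (2 * ε) ^ k) := by
  have hev : ∀ z, Continuous fun α => (v + probe w α) z := fun z =>
    LipObs.continuous_eval.comp ((continuous_add_probe hw v).prodMk continuous_const)
  refine infinitePi_le_of_extend_le _ hj ?_ fun α => ?_
  · simp only [ofPred_forall]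
    exact MeasurableSet.iInter fun a =>
      (isClosed_le ((hev _).sub (hev _)).abs continuous_const).measurableSet
  · refine le_trans (measure_mono fun β hβ => ?_) (pi_unitInterval_affine_le _ hdet
      (fun a => (v + probe w (Function.extend j 0 α)) (T^[a] x) -
        (v + probe w (Function.extend j 0 α)) (T^[a] y)) hε)
    intro a
    have hsum : ∀ z, (∑ b, (β b : ℝ) • w (j b) : LipObs X) z = ∑ b, (β b : ℝ) * w (j b) z := by
      intro z
      let E : LipObs X →+ ℝ :=
        { toFun := fun f => f z, map_zero' := rfl, map_add' := fun _ _ => rfl }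
      exact map_sum E _ _
    have h1 := hβ a
    rw [probe_extend hw hj] at h1
    simp only [LipObs.add_apply, hsum] at h1 ⊢
    have h2 : ∑ i, (Matrix.of fun a b : Fin k =>
        w (j b) (T^[a] x) - w (j b) (T^[a] y)) a i * (β i : ℝ) =
        ∑ b, (β b : ℝ) * w (j b) (T^[a] x) - ∑ b, (β b : ℝ) * w (j b) (T^[a] y) := by
      rw [← Finset.sum_sub_distrib]
      exact Finset.sum_congr rfl fun i _ => by rw [Matrix.of_apply]; ring
    rw [h2]
    convert h1 using 2
    ring

omit [CompactSpace X] in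
/-- If `k` point differences along the orbit of a pair are linearly dependent on the probes, then
the next observation is determined by the previous ones. -/
theorem exists_recurrence (hsep : ∀ m : X →₀ ℝ,
      (∀ n, Finsupp.linearCombination ℝ (w n) m = 0) → m = 0)
    (T : X → X) {k : ℕ} {x y : X} {c : Fin k → ℝ} (hc : c ≠ 0)
    (h : ∀ n, ∑ a, c a * (w n (T^[a] x) - w n (T^[a] y)) = 0) :
    ∃ d : Fin k → ℝ, ∀ f : X → ℝ,
      f (T^[k] x) - f (T^[k] y) = ∑ a, d a * (f (T^[a] x) - f (T^[a] y)) := by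
  let m : ℕ → X →₀ ℝ := fun a => Finsupp.single (T^[a] x) 1 - Finsupp.single (T^[a] y) 1
  have hm : ∀ a (f : X → ℝ), Finsupp.linearCombination ℝ f (m a) = f (T^[a] x) - f (T^[a] y) :=
    fun a f => by simp [m]
  have hstep : ∀ a, Finsupp.lmapDomain ℝ ℝ T (m a) = m (a + 1) := fun a => by
    simp [m, Finsupp.mapDomain_single, Function.iterate_succ_apply', Finsupp.mapDomain_sub]
  -- The combination with coefficients `c` is annihilated by every probe, hence vanishes as a
  -- finitely supported measure.
  have hdep : ¬ LinearIndependent ℝ fun a : Fin k => m a := by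
    intro hli
    refine hc (funext fun a => Fintype.linearIndependent_iff.1 hli c (hsep _ fun n => ?_) a)
    rw [map_sum, ← h n]
    exact Finset.sum_congr rfl fun a _ => by rw [map_smul, hm, smul_eq_mul]
  obtain ⟨d, hd⟩ := (Submodule.mem_span_range_iff_exists_fun ℝ).1
    (orbit_mem_span_of_not_linearIndependent _ m hstep k hdep)
  refine ⟨d, fun f => ?_⟩
  rw [← hm, ← hd, map_sum]
  exact Finset.sum_congr rfl fun a _ => by rw [map_smul, hm, smul_eq_mul]

/-- The dichotomy: either `k` probes have nonzero determinant at `p₀`, and the cost is `ε^k`, or a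
recurrence at `p₀` excludes ambiguity outright nearby, with constant `C = 0`. -/
theorem exists_nhds_coeffLaw_le (hw : Summable fun n => ‖w n‖)
    (hsep : ∀ m : X →₀ ℝ, (∀ n, Finsupp.linearCombination ℝ (w n) m = 0) → m = 0)
    {T : X → X} (hT : Continuous T) (v : LipObs X) (k : ℕ) {δ : ℝ} (hδ : 0 < δ) (p₀ : X × X) :
    ∃ U ∈ 𝓝 p₀, ∃ C ε₀ : ℝ, 0 ≤ C ∧ 0 < ε₀ ∧ ∀ p ∈ U, ∀ ε, 0 < ε → ε < ε₀ →
      coeffLaw {α | AmbiguousPair T ⇑(v + probe w α) k ε δ p.1 p.2} ≤ ENNReal.ofReal (C * ε ^ k) := by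
  have hTx : ∀ a, Continuous fun p : X × X => T^[a] p.1 := fun a =>
    (hT.iterate a).comp continuous_fst
  have hTy : ∀ a, Continuous fun p : X × X => T^[a] p.2 := fun a =>
    (hT.iterate a).comp continuous_snd
  rcases exists_det_ne_zero_or_exists_annihilator
    (fun n (a : Fin k) => w n (T^[a] p₀.1) - w n (T^[a] p₀.2)) with ⟨j, hj, hdet⟩ | ⟨c, hc, hc'⟩
  · have hcont : Continuous fun p : X × X => |(Matrix.of fun a b : Fin k =>
        w (j b) (T^[a] p.1) - w (j b) (T^[a] p.2)).det| := by
      refine (Continuous.matrix_det (continuous_matrix fun a b => ?_)).abs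
      exact ((w (j b)).continuous_coe.comp (hTx a)).sub ((w (j b)).continuous_coe.comp (hTy a))
    set s := |(Matrix.of fun a b : Fin k =>
        w (j b) (T^[a] p₀.1) - w (j b) (T^[a] p₀.2)).det| with hs
    have hs0 : 0 < s := abs_pos.2 hdet
    -- Where the determinant exceeds half its value at `p₀`, the small ball estimate has a common
    -- constant.
    refine ⟨_, (isOpen_lt continuous_const hcont).mem_nhds (half_lt_self hs0),
      (s / 2)⁻¹ * 2 ^ k, 1, by positivity, one_pos, fun p hp ε hε _ => ?_⟩
    have hp' : s / 2 < _ := hp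
    refine (measure_mono fun α hα => hα.1).trans ((coeffLaw_close_le hw T v hj
      (abs_pos.1 ((half_pos hs0).trans hp')) hε.le).trans (ENNReal.ofReal_le_ofReal ?_))
    rw [mul_pow, ← mul_assoc]
    gcongr
  · obtain ⟨d, hd⟩ := exists_recurrence hsep T hc hc'
    set R := ‖v‖ + ∑' n, ‖w n‖ with hR
    have hRn : ∀ α, ‖v + probe w α‖ ≤ R := fun α =>
      (norm_add_le _ _).trans (add_le_add le_rfl (norm_probe_le hw α))
    let r : ℕ → X × X → ℝ := fun a p =>
      dist (T^[a] p.1) (T^[a] p₀.1) + dist (T^[a] p.2) (T^[a] p₀.2)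
    have hr : ∀ a, Continuous (r a) := fun a =>
      ((hTx a).dist continuous_const).add ((hTy a).dist continuous_const)
    let G : X × X → ℝ := fun p => R * (∑ a : Fin k, |d a| * r a p + r k p)
    have hG : Continuous G := continuous_const.mul
      ((continuous_finsetSum Finset.univ fun (a : Fin k) _ =>
        show Continuous fun p => |d a| * r a p from continuous_const.mul (hr a)).add (hr k))
    have hG0 : G p₀ = 0 := by simp [G, r]
    have hclose : ∀ α a p, |((v + probe w α) (T^[a] p.1) - (v + probe w α) (T^[a] p.2)) -
        ((v + probe w α) (T^[a] p₀.1) - (v + probe w α) (T^[a] p₀.2))| ≤ R * r a p := by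
      intro α a p
      have h1 := LipObs.abs_sub_le (v + probe w α) (T^[a] p.1) (T^[a] p₀.1)
      have h2 := LipObs.abs_sub_le (v + probe w α) (T^[a] p.2) (T^[a] p₀.2)
      have h3 : ‖v + probe w α‖ * r a p ≤ R * r a p :=
        mul_le_mul_of_nonneg_right (hRn α) (by positivity)
      rw [sub_sub_sub_comm]
      refine (abs_sub _ _).trans (le_trans (add_le_add h1 h2) (le_trans (le_of_eq ?_) h3))
      simp only [r]
      ring
    have hS : 0 ≤ ∑ a, |d a| := Finset.sum_nonneg fun _ _ => abs_nonneg _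
    -- The next difference at `p` is at most `(∑ |d a|) ε + G p`; `G` is the cost of moving between
    -- `p` and `p₀`. Each term gets half of `δ`, and the added `1` keeps the denominator positive.
    refine ⟨_, (isOpen_lt hG continuous_const).mem_nhds (show G p₀ < δ / 2 by
      rw [hG0]; exact half_pos hδ), 0, δ / (2 * (1 + ∑ a, |d a|)), le_rfl, by positivity,
      fun p hp ε hε hεlt => ?_⟩
    have hp' : G p < δ / 2 := hp
    suffices h0 : {α | AmbiguousPair T ⇑(v + probe w α) k ε δ p.1 p.2} = ∅ by simp [h0]
    refine eq_empty_of_forall_notMem fun α hα => ?_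
    obtain ⟨h1, h2⟩ := hα
    have h3 : |(v + probe w α) (T^[k] p₀.1) - (v + probe w α) (T^[k] p₀.2)| ≤
        ∑ a : Fin k, |d a| * (ε + R * r a p) := by
      rw [hd]
      refine (Finset.abs_sum_le_sum_abs _ _).trans (Finset.sum_le_sum fun a _ => ?_)
      rw [abs_mul]
      refine mul_le_mul_of_nonneg_left ?_ (abs_nonneg _)
      have h4 := hclose α a p
      rw [abs_sub_comm] at h4
      have h5 := abs_sub_abs_le_abs_sub
        ((v + probe w α) (T^[a] p₀.1) - (v + probe w α) (T^[a] p₀.2))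
        ((v + probe w α) (T^[a] p.1) - (v + probe w α) (T^[a] p.2))
      linarith [h1 a]
    have h4 := hclose α k p
    have h5 := abs_sub_abs_le_abs_sub
        ((v + probe w α) (T^[k] p.1) - (v + probe w α) (T^[k] p.2))
        ((v + probe w α) (T^[k] p₀.1) - (v + probe w α) (T^[k] p₀.2))
    have h6 : ∑ a : Fin k, |d a| * (ε + R * r a p) + R * r k p = (∑ a, |d a|) * ε + G p := by
      simp only [G, mul_add, Finset.sum_add_distrib, Finset.sum_mul, Finset.mul_sum]
      rw [add_assoc]
      congr 2
      exact Finset.sum_congr rfl fun a _ => by ring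
    have h7 : (1 + ∑ a, |d a|) * ε < δ / 2 := by
      rw [lt_div_iff₀ (by positivity)] at hεlt
      linarith
    linarith

theorem exists_coeffLaw_ambiguousPair_le (hw : Summable fun n => ‖w n‖)
    (hsep : ∀ m : X →₀ ℝ, (∀ n, Finsupp.linearCombination ℝ (w n) m = 0) → m = 0)
    {T : X → X} (hT : Continuous T) (v : LipObs X) (k : ℕ) {δ : ℝ} (hδ : 0 < δ) :
    ∃ C ε₀ : ℝ, 0 ≤ C ∧ 0 < ε₀ ∧ ∀ x y, ∀ ε, 0 < ε → ε < ε₀ →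
      coeffLaw {α | AmbiguousPair T ⇑(v + probe w α) k ε δ x y} ≤ ENNReal.ofReal (C * ε ^ k) := by
  obtain ⟨C, ε₀, hC, hε₀, H⟩ := (isCompact_univ (X := X × X)).induction_on
    (p := fun s => ∃ C ε₀ : ℝ, 0 ≤ C ∧ 0 < ε₀ ∧ ∀ p ∈ s, ∀ ε, 0 < ε → ε < ε₀ →
      coeffLaw {α | AmbiguousPair T ⇑(v + probe w α) k ε δ p.1 p.2} ≤ ENNReal.ofReal (C * ε ^ k))
    ⟨0, 1, le_rfl, one_pos, by simp⟩
    (fun s t hst ⟨C, ε₀, hC, hε₀, H⟩ => ⟨C, ε₀, hC, hε₀, fun p hp => H p (hst hp)⟩)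
    (fun s t ⟨C, ε₀, hC, hε₀, H⟩ ⟨C', ε₀', _, hε₀', H'⟩ => by
      refine ⟨max C C', min ε₀ ε₀', hC.trans (le_max_left _ _), lt_min hε₀ hε₀',
        fun p hp ε hε hlt => ?_⟩
      rcases hp with hp | hp
      · refine (H p hp ε hε (hlt.trans_le (min_le_left _ _))).trans (ENNReal.ofReal_le_ofReal ?_)
        gcongr
        exact le_max_left _ _
      · refine (H' p hp ε hε (hlt.trans_le (min_le_right _ _))).trans (ENNReal.ofReal_le_ofReal ?_)
        gcongr
        exact le_max_right _ _)
    (fun p _ => by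
      obtain ⟨U, hU, h⟩ := exists_nhds_coeffLaw_le hw hsep hT v k hδ p
      exact ⟨U, mem_nhdsWithin_of_mem_nhds hU, h⟩)
  exact ⟨C, ε₀, hC, hε₀, fun x y => H (x, y) (mem_univ _)⟩

end Ambiguous

end

noncomputable section

/-! ### Probability that a point is ambiguous -/

section Nets

variable {X : Type*} [MetricSpace X] [CompactSpace X]

/-- As `L ≥ 1`, `R L^k` is a common Lipschitz constant of `h ∘ T^a` for all `a ≤ k`; two moved
points account for the factor `2`. -/
theorem AmbiguousPair.perturb {T : X → X} {L : ℝ≥0} (hT : LipschitzWith L T) (hL : 1 ≤ L)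
    {h : LipObs X} {R : ℝ} (hR : ‖h‖ ≤ R) {k : ℕ} {ε δ ρ : ℝ} {x y x' y' : X}
    (hx : dist x x' ≤ ρ) (hy : dist y y' ≤ ρ) (H : AmbiguousPair T h k ε δ x y) :
    AmbiguousPair T h k (ε + 2 * (R * L ^ k) * ρ) (δ - 2 * (R * L ^ k) * ρ) x' y' := by
  have hL' : (1 : ℝ) ≤ L := hL
  have hR0 : 0 ≤ R := (norm_nonneg _).trans hR
  have key : ∀ a ≤ k, ∀ z z', dist z z' ≤ ρ → |h (T^[a] z) - h (T^[a] z')| ≤ R * L ^ k * ρ := by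
    intro a ha z z' hz
    have h1 := (hT.iterate a).dist_le_mul z z'
    rw [NNReal.coe_pow] at h1
    calc |h (T^[a] z) - h (T^[a] z')| ≤ ‖h‖ * dist (T^[a] z) (T^[a] z') := h.abs_sub_le _ _
      _ ≤ R * (L ^ k * ρ) := by
        refine mul_le_mul hR (h1.trans (mul_le_mul (pow_le_pow_right₀ hL' ha) hz dist_nonneg ?_))
          dist_nonneg hR0
        positivity
      _ = R * L ^ k * ρ := by ring
  refine ⟨fun a => ?_, ?_⟩
  · have h1 := abs_le.1 (key a a.2.le x x' hx)
    have h2 := abs_le.1 (key a a.2.le y y' hy)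
    have h3 := abs_le.1 (H.1 a)
    rw [abs_le]
    constructor <;> linarith
  · have h1 := key k le_rfl x x' hx
    have h2 := key k le_rfl y y' hy
    have h3 := H.2
    have h4 := abs_sub_abs_le_abs_sub (h (T^[k] x) - h (T^[k] y)) (h (T^[k] x') - h (T^[k] y'))
    rw [sub_sub_sub_comm] at h4
    have h5 := abs_sub (h (T^[k] x) - h (T^[k] x')) (h (T^[k] y) - h (T^[k] y'))
    linarith

variable {w : ℕ → LipObs X}

/-- Union bound after snapping to the net. With `x` fixed only the partner is snapped, at the cost
of one factor `F.card`; otherwise both points are, which squares it. -/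
theorem exists_coeffLaw_ambiguousSet_le (hw : Summable fun n => ‖w n‖)
    (hsep : ∀ m : X →₀ ℝ, (∀ n, Finsupp.linearCombination ℝ (w n) m = 0) → m = 0)
    {T : X → X} {L : ℝ≥0} (hT : LipschitzWith L T) (v : LipObs X) (k : ℕ) {δ : ℝ} (hδ : 0 < δ) :
    ∃ C ε₀ : ℝ, 0 ≤ C ∧ 0 < ε₀ ∧ ∀ ε, 0 < ε → ε < ε₀ → ∀ F : Finset X,
      (∀ y, ∃ z ∈ F, dist y z ≤ ε) →
      (∀ x, coeffLaw {α | x ∈ ambiguousSet T ⇑(v + probe w α) k ε δ} ≤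
        ENNReal.ofReal (F.card * (C * ε ^ k))) ∧
      coeffLaw {α | (ambiguousSet T ⇑(v + probe w α) k ε δ).Nonempty} ≤
        ENNReal.ofReal (F.card ^ 2 * (C * ε ^ k)) := by
  obtain ⟨C, ε₁, hC, hε₁, H⟩ :=
    exists_coeffLaw_ambiguousPair_le hw hsep hT.continuous v k (half_pos hδ)
  have hT' : LipschitzWith (max 1 L) T := hT.weaken (le_max_right _ _)
  set R := ‖v‖ + ∑' n, ‖w n‖ with hR
  have hR0 : 0 ≤ R := add_nonneg (norm_nonneg _) (tsum_nonneg fun _ => norm_nonneg _)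
  have hRn : ∀ α, ‖v + probe w α‖ ≤ R := fun α =>
    (norm_add_le _ _).trans (add_le_add le_rfl (norm_probe_le hw α))
  set M : ℝ := 1 + 2 * (R * (max 1 L : ℝ≥0) ^ k) with hM
  have hM1 : 1 ≤ M := by
    rw [hM]
    have : 0 ≤ 2 * (R * ((max 1 L : ℝ≥0) : ℝ) ^ k) := by positivity
    linarith
  have hM0 : 0 < M := by linarith
  refine ⟨C * M ^ k, min (ε₁ / M) (δ / 2 / M), by positivity, by positivity,
    fun ε hε hlt F hF => ?_⟩
  have h1 : M * ε < ε₁ := by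
    have := hlt.trans_le (min_le_left _ _)
    rw [lt_div_iff₀ hM0] at this
    linarith
  have h2 : M * ε < δ / 2 := by
    have := hlt.trans_le (min_le_right _ _)
    rw [lt_div_iff₀ hM0] at this
    linarith
  have hpair : ∀ x y, coeffLaw {α | AmbiguousPair T ⇑(v + probe w α) k (M * ε) (δ / 2) x y} ≤
      ENNReal.ofReal (C * M ^ k * ε ^ k) := fun x y => by
    have := H x y (M * ε) (by positivity) h1
    rwa [mul_pow, ← mul_assoc] at this
  have hmove : ∀ α {x y x' y'}, dist x x' ≤ ε → dist y y' ≤ ε →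
      AmbiguousPair T ⇑(v + probe w α) k ε δ x y →
      AmbiguousPair T ⇑(v + probe w α) k (M * ε) (δ / 2) x' y' := by
    intro α x y x' y' hx hy h
    refine (h.perturb hT' (le_max_left _ _) (hRn α) hx hy).mono (le_of_eq ?_) ?_
    · rw [hM]; ring
    · have : M * ε = ε + 2 * (R * (max 1 L : ℝ≥0) ^ k) * ε := by rw [hM]; ring
      linarith
  constructor
  · intro x
    calc coeffLaw {α | x ∈ ambiguousSet T ⇑(v + probe w α) k ε δ}
        ≤ coeffLaw (⋃ z ∈ F, {α | AmbiguousPair T ⇑(v + probe w α) k (M * ε) (δ / 2) x z}) := by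
          refine measure_mono fun α hα => ?_
          obtain ⟨y, hy⟩ := hα
          obtain ⟨z, hz, hyz⟩ := hF y
          simp only [mem_iUnion]
          exact ⟨z, hz, hmove α (by simpa using hε.le) hyz hy⟩
      _ ≤ ∑ z ∈ F, ENNReal.ofReal (C * M ^ k * ε ^ k) :=
          (measure_biUnion_finset_le _ _).trans (Finset.sum_le_sum fun z _ => hpair x z)
      _ = ENNReal.ofReal (F.card * (C * M ^ k * ε ^ k)) := by
          rw [Finset.sum_const, nsmul_eq_mul, ← ENNReal.ofReal_natCast,
            ← ENNReal.ofReal_mul (by positivity)]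
  · calc coeffLaw {α | (ambiguousSet T ⇑(v + probe w α) k ε δ).Nonempty}
        ≤ coeffLaw (⋃ z ∈ F ×ˢ F,
          {α | AmbiguousPair T ⇑(v + probe w α) k (M * ε) (δ / 2) z.1 z.2}) := by
          refine measure_mono fun α hα => ?_
          obtain ⟨x, y, hy⟩ := hα
          obtain ⟨z, hz, hxz⟩ := hF x
          obtain ⟨z', hz', hyz⟩ := hF y
          simp only [mem_iUnion]
          exact ⟨(z, z'), Finset.mk_mem_product hz hz', hmove α hxz hyz hy⟩
      _ ≤ ∑ z ∈ F ×ˢ F, ENNReal.ofReal (C * M ^ k * ε ^ k) :=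
          (measure_biUnion_finset_le _ _).trans (Finset.sum_le_sum fun z _ => hpair _ _)
      _ = ENNReal.ofReal (F.card ^ 2 * (C * M ^ k * ε ^ k)) := by
          rw [Finset.sum_const, nsmul_eq_mul, Finset.card_product, ← sq, ← ENNReal.ofReal_natCast,
            ← ENNReal.ofReal_mul (by positivity), Nat.cast_pow]

end Nets

/-! ### Box dimensions -/

section BoxDim

variable {N : ℕ} {X : Set (EuclideanSpace ℝ (Fin N))}

theorem exists_net_card_le_coveringNum [CompactSpace X] [Nonempty X] {ε : ℝ} (hε : 0 < ε) :
    ∃ F : Finset X, F.card ≤ coveringNum X ε ∧ ∀ y, ∃ z ∈ F, dist y z ≤ ε := by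
  classical
  have hne : {n : ℕ | ∃ (c : Fin n → EuclideanSpace ℝ (Fin N)) (r : Fin n → ℝ),
      (∀ i, Metric.diam (Metric.ball (c i) (r i)) ≤ ε) ∧
        X ⊆ ⋃ i, Metric.ball (c i) (r i)}.Nonempty := by
    obtain ⟨t, -, ht, hcov⟩ := (isCompact_iff_compactSpace.2 ‹CompactSpace X›).finite_cover_balls
      (half_pos hε)
    refine ⟨ht.toFinset.card, fun i => ht.toFinset.equivFin.symm i, fun _ => ε / 2,
      fun i => (Metric.diam_ball (half_pos hε).le).trans (by linarith), hcov.trans ?_⟩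
    refine iUnion₂_subset fun c hc => ?_
    refine subset_iUnion_of_subset (ht.toFinset.equivFin ⟨c, ht.mem_toFinset.2 hc⟩) ?_
    simp
  obtain ⟨c, r, hdiam, hcov⟩ := Nat.sInf_mem hne
  -- Centres of covering balls may lie outside `X`; each is replaced by a point of `X` in its ball,
  -- and the diameter bound still gives distance at most `ε`.
  let f : Fin (coveringNum X ε) → X := fun i =>
    if h : ∃ x : X, (x : EuclideanSpace ℝ (Fin N)) ∈ Metric.ball (c i) (r i) then h.choose
      else Classical.arbitrary X
  refine ⟨Finset.univ.image f, Finset.card_image_le.trans (by simp), fun y => ?_⟩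
  obtain ⟨i, hi⟩ := mem_iUnion.1 (hcov y.2)
  refine ⟨f i, Finset.mem_image_of_mem _ (Finset.mem_univ i), ?_⟩
  have h : ∃ x : X, (x : EuclideanSpace ℝ (Fin N)) ∈ Metric.ball (c i) (r i) := ⟨y, hi⟩
  have hfi : f i = h.choose := dif_pos h
  rw [hfi]
  exact (Metric.dist_le_diam_of_mem Metric.isBounded_ball hi h.choose_spec).trans (hdiam i)

theorem natCast_le_rpow_of_log_div_lt {n : ℕ} {ε s : ℝ} (hε : 0 < ε) (hε1 : ε < 1)
    (h : Real.log n / (-Real.log ε) < s) : (n : ℝ) ≤ ε ^ (-s) := by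
  rcases Nat.eq_zero_or_pos n with rfl | hn
  · simpa using Real.rpow_nonneg hε.le _
  · rw [div_lt_iff₀ (neg_pos.2 (Real.log_neg hε hε1))] at h
    rw [Real.le_rpow_iff_log_le (by exact_mod_cast hn) hε]
    linarith

theorem eventually_Ioo_zero_one : ∀ᶠ ε : ℝ in 𝓝[>] 0, 0 < ε ∧ ε < 1 :=
  Ioo_mem_nhdsGT one_pos

theorem lowerBoxDim_nonneg : 0 ≤ lowerBoxDim X := by
  refine le_liminf_of_le (by isBoundedDefault) ?_
  filter_upwards [eventually_Ioo_zero_one] with ε hε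
  rw [← EReal.coe_zero, EReal.coe_le_coe_iff]
  exact div_nonneg (Real.log_natCast_nonneg _) (neg_nonneg.2 (Real.log_neg hε.1 hε.2).le)

theorem upperBoxDim_nonneg : 0 ≤ upperBoxDim X :=
  lowerBoxDim_nonneg.trans (liminf_le_limsup)

theorem eventually_coveringNum_le {s : ℝ} (h : upperBoxDim X < (s : EReal)) :
    ∀ᶠ ε : ℝ in 𝓝[>] 0, (coveringNum X ε : ℝ) ≤ ε ^ (-s) := by
  filter_upwards [eventually_Ioo_zero_one, eventually_lt_of_limsup_lt h] with ε hε hlt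
  exact natCast_le_rpow_of_log_div_lt hε.1 hε.2 (EReal.coe_lt_coe_iff.1 hlt)

theorem frequently_coveringNum_le {s : ℝ} (h : lowerBoxDim X < (s : EReal)) :
    ∃ᶠ ε : ℝ in 𝓝[>] 0, (coveringNum X ε : ℝ) ≤ ε ^ (-s) := by
  refine ((frequently_lt_of_liminf_lt (by isBoundedDefault) h).and_eventually
    eventually_Ioo_zero_one).mono fun ε hε => ?_
  exact natCast_le_rpow_of_log_div_lt hε.2.1 hε.2.2 (EReal.coe_lt_coe_iff.1 hε.1)

end BoxDim

/-! ### Almost sure statements -/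

section AlmostSure

variable {N : ℕ} {X : Set (EuclideanSpace ℝ (Fin N))} [CompactSpace X] [Nonempty X]
  {w : ℕ → LipObs X}

/-- The exceptional event lies in the nonemptiness event at every scale, so a single scale with
probability below its measure gives a contradiction. Hence the lower dimension, which controls only
some small scales, is enough. -/
theorem ae_exists_ambiguousSet_eq_empty (hw : Summable fun n => ‖w n‖)
    (hsep : ∀ m : X →₀ ℝ, (∀ n, Finsupp.linearCombination ℝ (w n) m = 0) → m = 0)
    {T : X → X} {L : ℝ≥0} (hT : LipschitzWith L T) (v : LipObs X) (k : ℕ)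
    (hk : 2 * lowerBoxDim X < (k : EReal)) {δ : ℝ} (hδ : 0 < δ) :
    ∀ᵐ α ∂coeffLaw, ∃ n : ℕ, ambiguousSet T ⇑(v + probe w α) k (1 / (n + 1)) δ = ∅ := by
  obtain ⟨s, hs1, hs2⟩ : ∃ s : ℝ, lowerBoxDim X < (s : EReal) ∧ 2 * s < k := by
    have h1 : lowerBoxDim X < ((k / 2 : ℝ) : EReal) := by
      by_contra hge
      refine absurd hk (not_lt.2 ?_)
      have h2 := mul_le_mul_of_nonneg_left (not_lt.1 hge) (show (0 : EReal) ≤ 2 by norm_num)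
      refine le_trans (le_of_eq ?_) h2
      rw [show (2 : EReal) = ((2 : ℝ) : EReal) from rfl, ← EReal.coe_mul,
        mul_div_cancel₀ _ two_ne_zero]
      rfl
    obtain ⟨s, hs1, hs2⟩ := EReal.lt_iff_exists_real_btwn.1 h1
    refine ⟨s, hs1, ?_⟩
    have := EReal.coe_lt_coe_iff.1 hs2
    linarith
  obtain ⟨C, ε₀, hC, hε₀, H⟩ := exists_coeffLaw_ambiguousSet_le hw hsep hT v k hδ
  rw [ae_iff]
  by_contra hne
  have hlim : Tendsto (fun ε : ℝ => ENNReal.ofReal (C * ε ^ (k - 2 * s))) (𝓝[>] 0) (𝓝 0) := by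
    have h1 : Tendsto (fun ε : ℝ => C * ε ^ (k - 2 * s)) (𝓝[>] 0) (𝓝 (C * 0 ^ (k - 2 * s))) :=
      ((Real.continuousAt_rpow_const 0 (k - 2 * s) (Or.inr (by linarith))).tendsto.mono_left
        nhdsWithin_le_nhds).const_mul C
    rw [Real.zero_rpow (by linarith), mul_zero] at h1
    simpa using ENNReal.tendsto_ofReal h1
  have hsmall : ∀ᶠ ε : ℝ in 𝓝[>] 0, 0 < ε ∧ ε < ε₀ := Ioo_mem_nhdsGT hε₀
  obtain ⟨ε, ⟨hN, hlt⟩, hε, hεlt⟩ := (((frequently_coveringNum_le hs1).and_eventually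
    (hlim.eventually (gt_mem_nhds (pos_iff_ne_zero.2 hne)))).and_eventually hsmall).exists
  obtain ⟨F, hFN, hF⟩ := exists_net_card_le_coveringNum (X := X) hε
  refine absurd hlt (not_lt.2 ((measure_mono fun α hα => ?_).trans
    ((H ε hε hεlt F hF).2.trans (ENNReal.ofReal_le_ofReal ?_))))
  · have hα' : ¬ ∃ n : ℕ, ambiguousSet T ⇑(v + probe w α) k (1 / (n + 1)) δ = ∅ := hα
    push Not at hα'
    obtain ⟨n, hn⟩ := exists_nat_one_div_lt hε
    exact (hα' n).mono (ambiguousSet_mono hn.le le_rfl)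
  · have h1 : (F.card : ℝ) ≤ ε ^ (-s) := le_trans (by exact_mod_cast hFN) hN
    calc (F.card : ℝ) ^ 2 * (C * ε ^ k) ≤ (ε ^ (-s)) ^ 2 * (C * ε ^ k) := by gcongr
      _ = C * ε ^ (k - 2 * s) := by
        rw [← Real.rpow_natCast ε k, ← Real.rpow_natCast (ε ^ (-s)) 2, ← Real.rpow_mul hε.le,
          mul_left_comm, ← Real.rpow_add hε]
        congr 2
        push_cast
        ring

/-- The expected measure is of order `ε^(k - D - θ/2)`, so Markov at level `ε^(k - D - θ)` leaves
`ε^(θ/2)`, summable over `ε = 2⁻ⁿ`. -/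
theorem ae_eventually_measure_ambiguousSet_le (hw : Summable fun n => ‖w n‖)
    (hsep : ∀ m : X →₀ ℝ, (∀ n, Finsupp.linearCombination ℝ (w n) m = 0) → m = 0)
    (μ : Measure X) [IsProbabilityMeasure μ]
    {T : X → X} {L : ℝ≥0} (hT : LipschitzWith L T) (v : LipObs X) (k : ℕ) {D : ℝ}
    (hD : upperBoxDim X = (D : EReal)) {δ θ : ℝ} (hδ : 0 < δ) (hθ : 0 < θ) :
    ∀ᵐ α ∂coeffLaw, ∀ᶠ n : ℕ in atTop,
      μ (ambiguousSet T ⇑(v + probe w α) k ((1 / 2) ^ n) δ) ≤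
        ENNReal.ofReal (((1 / 2 : ℝ) ^ n) ^ (k - D - θ)) := by
  obtain ⟨C, ε₀, hC, hε₀, H⟩ := exists_coeffLaw_ambiguousSet_le hw hsep hT v k hδ
  have hup : upperBoxDim X < ((D + θ / 2 : ℝ) : EReal) := by
    rw [hD, EReal.coe_lt_coe_iff]
    linarith
  set E : ℕ → Set (ℕ → unitInterval) := fun n =>
    {α | ENNReal.ofReal (((1 / 2 : ℝ) ^ n) ^ (k - D - θ)) ≤
      μ (ambiguousSet T ⇑(v + probe w α) k ((1 / 2) ^ n) δ)} with hE
  have hlim : Tendsto (fun n : ℕ => (1 / 2 : ℝ) ^ n) atTop (𝓝[>] 0) :=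
    tendsto_nhdsWithin_iff.2 ⟨tendsto_pow_atTop_nhds_zero_of_lt_one (by norm_num) (by norm_num),
      Eventually.of_forall fun n => by simp⟩
  have hbound : ∀ᶠ n in atTop, coeffLaw (E n) ≤
      ENNReal.ofReal (C * ((1 / 2 : ℝ) ^ (θ / 2)) ^ n) := by
    filter_upwards [hlim.eventually (eventually_coveringNum_le hup),
      hlim.eventually (Ioo_mem_nhdsGT hε₀)] with n hN hn
    set ε : ℝ := (1 / 2) ^ n with hεn
    obtain ⟨hε, hεlt⟩ := hn
    obtain ⟨F, hFN, hF⟩ := exists_net_card_le_coveringNum (X := X) hε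
    have hS : MeasurableSet {p : (ℕ → unitInterval) × X |
        p.2 ∈ ambiguousSet T ⇑(v + probe w p.1) k ε δ} := by
      have := (isClosed_ambiguousSet_prod hT.continuous k ε δ).preimage
        (((continuous_add_probe hw v).comp continuous_fst).prodMk
          (continuous_snd (X := ℕ → unitInterval) (Y := X)))
      exact this.measurableSet
    have hint : ∫⁻ α, μ (ambiguousSet T ⇑(v + probe w α) k ε δ) ∂coeffLaw ≤
        ENNReal.ofReal (F.card * (C * ε ^ k)) := by
      have h1 := (Measure.prod_apply (μ := coeffLaw) (ν := μ) hS).symm.trans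
        (Measure.prod_apply_symm hS)
      refine (le_of_eq h1).trans ((lintegral_mono fun x => (H ε hε hεlt F hF).1 x).trans ?_)
      simp
    have hpos : 0 < ε ^ (k - D - θ) := Real.rpow_pos_of_pos hε _
    refine (meas_ge_le_lintegral_div (measurable_measure_prodMk_left hS).aemeasurable
      (ENNReal.ofReal_pos.2 hpos).ne' ENNReal.ofReal_ne_top).trans ?_
    refine (ENNReal.div_le_div_right hint _).trans ?_
    rw [← ENNReal.ofReal_div_of_pos hpos]
    refine ENNReal.ofReal_le_ofReal ?_
    have h1 : (F.card : ℝ) ≤ ε ^ (-(D + θ / 2)) := le_trans (by exact_mod_cast hFN) hN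
    calc F.card * (C * ε ^ k) / ε ^ (k - D - θ)
        ≤ ε ^ (-(D + θ / 2)) * (C * ε ^ k) / ε ^ (k - D - θ) := by gcongr
      _ = C * ε ^ (θ / 2) := by
        rw [← Real.rpow_natCast ε k, mul_left_comm, mul_div_assoc, ← Real.rpow_add hε,
          ← Real.rpow_sub hε]
        congr 2
        ring
      _ = C * ((1 / 2 : ℝ) ^ (θ / 2)) ^ n := by
        rw [hεn, ← Real.rpow_natCast, ← Real.rpow_natCast, ← Real.rpow_mul (by norm_num),
          ← Real.rpow_mul (by norm_num), mul_comm (n : ℝ)]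
  obtain ⟨n₀, hn₀⟩ := eventually_atTop.1 hbound
  have hr1 : (1 / 2 : ℝ) ^ (θ / 2) < 1 :=
    Real.rpow_lt_one (by norm_num) (by norm_num) (by linarith)
  have hr0 : 0 ≤ (1 / 2 : ℝ) ^ (θ / 2) := Real.rpow_nonneg (by norm_num) _
  have hsum : ∑' n, coeffLaw (E (n + n₀)) ≠ ∞ := by
    refine ne_top_of_le_ne_top ?_ (ENNReal.tsum_le_tsum fun n => hn₀ (n + n₀) (by omega))
    refine Summable.tsum_ofReal_ne_top ?_
    exact ((summable_nat_add_iff n₀).2 (summable_geometric_of_lt_one hr0 hr1)).mul_left C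
  filter_upwards [ae_eventually_notMem hsum] with α hα
  obtain ⟨n₁, hn₁⟩ := eventually_atTop.1 hα
  refine eventually_atTop.2 ⟨n₁ + n₀, fun n hn => ?_⟩
  have h1 := hn₁ (n - n₀) (by omega)
  rw [Nat.sub_add_cancel (by omega)] at h1
  exact (not_le.1 h1).le

end AlmostSure

end

noncomputable section

/-! ### The prediction error and ambiguous points -/

section Prediction

variable {X : Type*} [MetricSpace X]

theorem continuous_delayMap {T : X → X} (hT : Continuous T) {h : X → ℝ} (hh : Continuous h)
    (k : ℕ) : Continuous (delayMap T h k) :=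
  (PiLp.continuous_toLp 2 _).comp
    (continuous_pi fun a : Fin k => hh.comp (hT.iterate a))

omit [MetricSpace X] in
theorem abs_sub_le_dist_delayMap (T : X → X) (h : X → ℝ) {k : ℕ} (x y : X) (a : Fin k) :
    |h (T^[a] x) - h (T^[a] y)| ≤ dist (delayMap T h k x) (delayMap T h k y) := by
  rw [dist_eq_norm]
  exact PiLp.norm_apply_le (delayMap T h k x - delayMap T h k y) a

variable [CompactSpace X]

theorem mem_ambiguousSet_of_lt_predError [MeasurableSpace X] [BorelSpace X] (μ : Measure X)
    [IsProbabilityMeasure μ] {T : X → X} (hT : Continuous T) {h : X → ℝ} (hh : Continuous h)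
    {k : ℕ} {ε δ : ℝ} (hδ : 0 < δ) (hε : ε < δ / (2 * (k + 1))) {x : X}
    (H : δ < predError μ T h k ε (delayMap T h k x)) :
    x ∈ ambiguousSet T h k ε (δ / (2 * (k + 1))) := by
  have hφ := continuous_delayMap hT hh k
  set A := delayMap T h k ⁻¹' Metric.ball (delayMap T h k x) ε with hA
  have hAm : MeasurableSet A := (Metric.isOpen_ball.preimage hφ).measurableSet
  -- If all values lay in the closed `δ/2`-ball about `φ(Tx)`, so would their mean by convexity, and
  -- the deviation would be at most `δ`.
  obtain ⟨y, hyA, hy⟩ : ∃ y ∈ A, δ / 2 < dist (delayMap T h k (T y)) (delayMap T h k (T x)) := by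
    by_contra! hall
    refine absurd H (not_lt.2 ?_)
    rw [predError, ← hA]
    rcases eq_or_ne (μ A) 0 with h0 | h0
    · simp [Measure.real, h0, hδ.le]
    have hpos : 0 < μ.real A := ENNReal.toReal_pos h0 (measure_ne_top _ _)
    have hmean : predMean μ T h k ε (delayMap T h k x) ∈
        Metric.closedBall (delayMap T h k (T x)) (δ / 2) := by
      have h1 := (convex_closedBall (delayMap T h k (T x)) (δ / 2)).set_average_mem
        Metric.isClosed_closedBall h0 (measure_ne_top _ _)
        (f := fun z => delayMap T h k (T z)) ((ae_restrict_iff' hAm).2 (ae_of_all _ hall))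
        ((hφ.comp hT).continuousOn.integrableOn_compact isCompact_univ |>.mono_set
          (subset_univ _))
      rwa [setAverage_eq] at h1
    set c := predMean μ T h k ε (delayMap T h k x)
    have hint : ∫ z in A, ‖delayMap T h k (T z) - c‖ ^ 2 ∂μ ≤ δ ^ 2 * μ.real A := by
      refine (Real.le_norm_self _).trans (norm_setIntegral_le_of_norm_le_const
        (measure_lt_top _ _) fun z hz => ?_)
      rw [Real.norm_of_nonneg (by positivity)]
      have h1 : ‖delayMap T h k (T z) - c‖ ≤ δ := by
        rw [← dist_eq_norm]
        refine (dist_triangle_right _ _ (delayMap T h k (T x))).trans ?_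
        have h2 := hall z hz
        have h3 := Metric.mem_closedBall.1 hmean
        linarith
      gcongr
    refine Real.sqrt_le_iff.2 ⟨hδ.le, ?_⟩
    rw [inv_mul_le_iff₀ hpos]
    linarith
  have hclose : ∀ a : Fin k, |h (T^[a] x) - h (T^[a] y)| < ε := fun a =>
    (abs_sub_le_dist_delayMap T h x y a).trans_lt (by rw [dist_comm]; exact hyA)
  refine ⟨y, fun a => (hclose a).le, ?_⟩
  by_contra! hlt
  refine absurd hy (not_lt.2 ?_)
  set c := δ / (2 * (k + 1)) with hc
  have hc0 : 0 < c := by positivity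
  -- All coordinates but the last are shifted coordinates of `φ`, already `ε`-close. Coordinates
  -- bounded by `c` give norm at most `√k c ≤ (k + 1) c = δ / 2`.
  have hcoord : ∀ a : Fin k, |h (T^[a] (T y)) - h (T^[a] (T x))| ≤ c := by
    intro a
    rw [← Function.iterate_succ_apply, ← Function.iterate_succ_apply, abs_sub_comm]
    rcases Nat.lt_or_ge (a + 1) k with hak | hak
    · exact ((hclose ⟨a + 1, hak⟩).trans hε).le
    · have : (a : ℕ) + 1 = k := by omega
      rw [Nat.succ_eq_add_one, this]
      exact hlt.le
  rw [EuclideanSpace.dist_eq]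
  refine Real.sqrt_le_iff.2 ⟨by positivity, ?_⟩
  calc ∑ a, dist (delayMap T h k (T y) a) (delayMap T h k (T x) a) ^ 2
      ≤ ∑ _a : Fin k, c ^ 2 := by
        refine Finset.sum_le_sum fun a _ => ?_
        rw [Real.dist_eq]
        exact pow_le_pow_left₀ (abs_nonneg _) (hcoord a) 2
    _ = k * c ^ 2 := by simp
    _ ≤ (k + 1) ^ 2 * c ^ 2 := by
        have : (k : ℝ) ≤ (k + 1) ^ 2 := by nlinarith [(Nat.cast_nonneg k : (0 : ℝ) ≤ k)]
        gcongr
    _ = (δ / 2) ^ 2 := by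
        rw [hc]
        field_simp

/-- Pairs whose next observations are `δ`-apart form a compact set off the diagonal, where
injectivity keeps the delay vectors a positive distance apart. -/
theorem exists_ambiguousSet_eq_empty_of_injective {T : X → X} (hT : Continuous T) {h : X → ℝ}
    (hh : Continuous h) {k : ℕ} (hinj : Function.Injective (delayMap T h k)) {δ : ℝ}
    (hδ : 0 < δ) : ∃ ε > 0, ambiguousSet T h k ε δ = ∅ := by
  have hφ := continuous_delayMap hT hh k
  have hcont : Continuous fun p : X × X => |h (T^[k] p.1) - h (T^[k] p.2)| :=
    ((hh.comp ((hT.iterate k).comp continuous_fst)).sub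
      (hh.comp ((hT.iterate k).comp continuous_snd))).abs
  have hK : IsCompact {p : X × X | δ ≤ |h (T^[k] p.1) - h (T^[k] p.2)|} :=
    (isClosed_le continuous_const hcont).isCompact
  have hg : Continuous fun p : X × X =>
      ∑ a : Fin k, |h (T^[a] p.1) - h (T^[a] p.2)| :=
    continuous_finsetSum _ fun a _ => ((hh.comp ((hT.iterate a).comp continuous_fst)).sub
      (hh.comp ((hT.iterate a).comp continuous_snd))).abs
  obtain ⟨η, hη, H⟩ := hK.exists_forall_le' hg.continuousOn (a := 0) fun p hp => by
    refine lt_of_le_of_ne (Finset.sum_nonneg fun _ _ => abs_nonneg _) fun h0 => ?_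
    have h1 : delayMap T h k p.1 = delayMap T h k p.2 := by
      ext a
      exact sub_eq_zero.1 (abs_eq_zero.1 ((Finset.sum_eq_zero_iff_of_nonneg
        fun _ _ => abs_nonneg _).1 h0.symm a (Finset.mem_univ a)))
    have h2 : δ ≤ |h (T^[k] p.1) - h (T^[k] p.2)| := hp
    rw [hinj h1, sub_self, abs_zero] at h2
    linarith
  refine ⟨η / (k + 1), by positivity, eq_empty_of_forall_notMem ?_⟩
  rintro x ⟨y, hy1, hy2⟩
  have h1 : η ≤ ∑ a : Fin k, |h (T^[a] x) - h (T^[a] y)| := H (x, y) hy2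
  have h2 := h1.trans (Finset.sum_le_sum fun a _ => hy1 a)
  simp only [Finset.sum_const, Finset.card_univ, Fintype.card_fin, nsmul_eq_mul] at h2
  rw [mul_div_assoc', le_div_iff₀ (by positivity)] at h2
  linarith

end Prediction

/-- If the measures of an increasing family of sets are at most `εᵉ` along `ε = 2⁻ⁿ`, then they
are at most a constant times `εᵉ` for all small `ε`. -/
theorem exists_measureReal_le_rpow_of_dyadic {X : Type*} [MeasurableSpace X] (μ : Measure X)
    [IsProbabilityMeasure μ] {S : ℝ → Set X} (hS : Monotone S) {e : ℝ}
    (h : ∀ᶠ n : ℕ in atTop, μ (S ((1 / 2) ^ n)) ≤ ENNReal.ofReal (((1 / 2 : ℝ) ^ n) ^ e)) :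
    ∃ C > 0, ∃ ε₀ > 0, ∀ ε, 0 < ε → ε < ε₀ → μ.real (S ε) ≤ C * ε ^ e := by
  obtain ⟨n₀, hn₀⟩ := eventually_atTop.1 h
  -- With `ε ≤ t ≤ 2ε` for a dyadic `t`, passing from `t^e` to `ε^e` costs at most `2^|e|`, whatever
  -- the sign of `e`.
  refine ⟨2 ^ |e|, by positivity, (1 / 2) ^ n₀, by positivity, fun ε hε hlt => ?_⟩
  obtain ⟨n, hn1, hn2⟩ := exists_nat_pow_near_of_lt_one (y := (1 / 2 : ℝ)) hε
    (hlt.le.trans (pow_le_one₀ (by norm_num) (by norm_num))) (by norm_num) (by norm_num)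
  have hn : n₀ ≤ n := by
    by_contra! hlt'
    have h1 : (1 / 2 : ℝ) ^ n₀ ≤ (1 / 2) ^ (n + 1) :=
      pow_le_pow_of_le_one (by norm_num) (by norm_num) hlt'
    linarith
  set t : ℝ := (1 / 2) ^ n with ht
  have ht0 : 0 < t := by positivity
  have ht2 : t ≤ 2 * ε := by
    rw [pow_succ, ← ht] at hn1
    linarith
  have h1 : μ.real (S ε) ≤ t ^ e :=
    ENNReal.toReal_le_of_le_ofReal (Real.rpow_nonneg ht0.le _)
      ((measure_mono (hS hn2)).trans (hn₀ n hn))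
  refine h1.trans ?_
  rcases le_total 0 e with he | he
  · rw [abs_of_nonneg he, ← Real.mul_rpow (by norm_num) hε.le]
    exact Real.rpow_le_rpow ht0.le ht2 he
  · refine (Real.rpow_le_rpow_of_nonpos hε hn2 he).trans ?_
    exact le_mul_of_one_le_left (Real.rpow_nonneg hε.le _)
      (Real.one_le_rpow (by norm_num) (abs_nonneg _))

/-! ### The prevalent set -/

section GoodSet

variable {N : ℕ} {X : Set (EuclideanSpace ℝ (Fin N))} [CompactSpace X]

/-- The observables whose ambiguous sets are small in measure, or empty, at the rates dictated by
the box dimensions. -/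
def goodObs (μ : Measure X) (T : X → X) : Set (LipObs X) :=
  {h | ∀ k m : ℕ,
    (upperBoxDim X < (k : EReal) → ∀ᶠ n : ℕ in atTop,
      μ (ambiguousSet T h k ((1 / 2) ^ n) (1 / (m + 1))) ≤
        ENNReal.ofReal (((1 / 2 : ℝ) ^ n) ^ (k - (upperBoxDim X).toReal - 1 / (m + 1)))) ∧
    (2 * lowerBoxDim X < (k : EReal) → ∃ n : ℕ,
      ambiguousSet T h k (1 / (n + 1)) (1 / (m + 1)) = ∅)}

theorem measurableSet_goodObs (μ : Measure X) [IsProbabilityMeasure μ] {T : X → X}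
    (hT : Continuous T) : MeasurableSet (goodObs μ T) := by
  have h1 : ∀ (k : ℕ) (ε δ c : ℝ),
      MeasurableSet {h : LipObs X | μ (ambiguousSet T h k ε δ) ≤ ENNReal.ofReal c} :=
    fun k ε δ c => measurableSet_le
      (measurable_measure_prodMk_left (isClosed_ambiguousSet_prod hT k ε δ).measurableSet)
      measurable_const
  have h2 : ∀ (k : ℕ) (ε δ : ℝ),
      MeasurableSet {h : LipObs X | ambiguousSet T h k ε δ = ∅} := fun k ε δ => by
    convert (isClosed_nonempty_ambiguousSet hT k ε δ).measurableSet.compl using 1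
    ext h
    exact not_nonempty_iff_eq_empty.symm
  refine MeasurableSet.congr (s := ⋂ k : ℕ, ⋂ m : ℕ,
    (⋂ _ : upperBoxDim X < (k : EReal), ⋃ n₀ : ℕ, ⋂ n : ℕ, ⋂ _ : n₀ ≤ n,
      {h : LipObs X | μ (ambiguousSet T h k ((1 / 2) ^ n) (1 / (m + 1))) ≤
        ENNReal.ofReal (((1 / 2 : ℝ) ^ n) ^ (k - (upperBoxDim X).toReal - 1 / (m + 1)))}) ∩
    ⋂ _ : 2 * lowerBoxDim X < (k : EReal), ⋃ n : ℕ,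
      {h : LipObs X | ambiguousSet T h k (1 / (n + 1)) (1 / (m + 1)) = ∅}) ?_ ?_
  · exact .iInter fun k => .iInter fun m => .inter
      (.iInter fun _ => .iUnion fun _ => .iInter fun _ => .iInter fun _ => h1 _ _ _ _)
      (.iInter fun _ => .iUnion fun _ => h2 _ _ _)
  · ext h
    simp only [goodObs, mem_iInter, mem_inter_iff, mem_iUnion, eventually_atTop]
    rfl

omit [CompactSpace X] in
theorem upperBoxDim_eq_coe_toReal {k : ℕ} (h : upperBoxDim X < (k : EReal)) :
    upperBoxDim X = ((upperBoxDim X).toReal : EReal) :=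
  (EReal.coe_toReal (h.trans_le le_top).ne
    (EReal.bot_lt_zero.trans_le upperBoxDim_nonneg).ne').symm

/-- Only countably many conditions, indexed by `k` and `m`, are imposed, so the almost sure
statements can be intersected. -/
theorem isPrevalent_goodObs [Nonempty X] (μ : Measure X) [IsProbabilityMeasure μ] {T : X → X}
    {L : ℝ≥0} (hT : LipschitzWith L T) : IsPrevalent (goodObs μ T) := by
  obtain ⟨w, hw, hsep⟩ := exists_summable_separating_seq (X := X)
  refine isPrevalent_of_probe hw (measurableSet_goodObs μ hT.continuous) fun v => ?_
  refine ae_all_iff.2 fun k => ae_all_iff.2 fun m => ?_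
  have hm : (0 : ℝ) < 1 / (m + 1) := by positivity
  refine Filter.Eventually.and ?_ ?_
  · by_cases hk : upperBoxDim X < (k : EReal)
    · filter_upwards [ae_eventually_measure_ambiguousSet_le hw hsep μ hT v k
        (upperBoxDim_eq_coe_toReal hk) hm hm] with α hα _ using hα
    · exact ae_of_all _ fun _ h => absurd h hk
  · by_cases hk : 2 * lowerBoxDim X < (k : EReal)
    · filter_upwards [ae_exists_ambiguousSet_eq_empty hw hsep hT v k hk hm] with α hα _ using hα
    · exact ae_of_all _ fun _ h => absurd h hk

end GoodSet

end

/-! ### From ambiguous sets to prediction errors -/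

theorem theorem1p8 {N : ℕ} (X : Set (EuclideanSpace ℝ (Fin N))) [CompactSpace X]
    (μ : Measure X) [IsProbabilityMeasure μ] (T : X → X) (hT : ∃ L : ℝ≥0, LipschitzWith L T) :
    ∃ S : Set (LipObs X), IsPrevalent S ∧
      ∀ h ∈ S, ∀ k : ℕ, ∀ δ > (0 : ℝ), ∀ θ > (0 : ℝ),
        ∃ C > (0 : ℝ), ∃ ε₀ > (0 : ℝ), ∀ ε : ℝ, 0 < ε → ε < ε₀ →
          (upperBoxDim X < (k : EReal) →
            μ.real {x : X | predError μ T h k ε (delayMap T h k x) > δ} ≤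
              C * ε ^ ((k : ℝ) - (upperBoxDim X).toReal - θ)) ∧
          (2 * lowerBoxDim X < (k : EReal) ∨ Function.Injective (delayMap T h k) →
            {x : X | predError μ T h k ε (delayMap T h k x) > δ} = ∅) := by
  obtain ⟨L, hL⟩ := hT
  have hX : Nonempty X := nonempty_of_isProbabilityMeasure μ
  refine ⟨goodObs μ T, isPrevalent_goodObs μ hL, fun h hh k δ hδ θ hθ => ?_⟩
  set δ' : ℝ := δ / (2 * (k + 1)) with hδ'
  have hδ'0 : 0 < δ' := by positivity
  -- One `m` serves both as separation threshold and as loss in the exponent.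
  obtain ⟨m, hm⟩ := exists_nat_one_div_lt (lt_min hδ'0 hθ)
  have hmδ : 1 / ((m : ℝ) + 1) ≤ δ' := hm.le.trans (min_le_left _ _)
  have hmθ : 1 / ((m : ℝ) + 1) ≤ θ := hm.le.trans (min_le_right _ _)
  have hm0 : (0 : ℝ) < 1 / (m + 1) := by positivity
  have hsub : ∀ ε < δ', {x : X | predError μ T h k ε (delayMap T h k x) > δ} ⊆
      ambiguousSet T h k ε (1 / (m + 1)) := fun ε hε x hx =>
    ambiguousSet_mono le_rfl hmδ
      (mem_ambiguousSet_of_lt_predError μ hL.continuous h.continuous_coe hδ hε hx)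
  obtain ⟨C, hC, ε₁, hε₁, H1⟩ : ∃ C > (0 : ℝ), ∃ ε₁ > (0 : ℝ), ∀ ε, 0 < ε → ε < ε₁ →
      upperBoxDim X < (k : EReal) → μ.real (ambiguousSet T h k ε (1 / (m + 1))) ≤
        C * ε ^ ((k : ℝ) - (upperBoxDim X).toReal - 1 / (m + 1)) := by
    by_cases hk : upperBoxDim X < (k : EReal)
    · obtain ⟨C, hC, ε₁, hε₁, H⟩ := exists_measureReal_le_rpow_of_dyadic μ
        (S := fun ε => ambiguousSet T h k ε (1 / (m + 1)))
        (fun _ _ h => ambiguousSet_mono h le_rfl) ((hh k m).1 hk)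
      exact ⟨C, hC, ε₁, hε₁, fun ε h1 h2 _ => H ε h1 h2⟩
    · exact ⟨1, one_pos, 1, one_pos, fun _ _ _ h => absurd h hk⟩
  obtain ⟨ε₂, hε₂, H2⟩ : ∃ ε₂ > (0 : ℝ),
      (2 * lowerBoxDim X < (k : EReal) ∨ Function.Injective (delayMap T h k) →
        ambiguousSet T h k ε₂ (1 / (m + 1)) = ∅) := by
    by_cases hk : 2 * lowerBoxDim X < (k : EReal)
    · obtain ⟨n, hn⟩ := (hh k m).2 hk
      exact ⟨1 / (n + 1), by positivity, fun _ => hn⟩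
    · by_cases hinj : Function.Injective (delayMap T h k)
      · obtain ⟨ε₂, hε₂, H⟩ := exists_ambiguousSet_eq_empty_of_injective hL.continuous
          h.continuous_coe hinj hm0
        exact ⟨ε₂, hε₂, fun _ => H⟩
      · exact ⟨1, one_pos, fun h => absurd h (by tauto)⟩
  -- The bound `ε < 1` allows the exponent loss `1 / (m + 1)` to be weakened to `θ`.
  refine ⟨C, hC, min (min 1 δ') (min ε₁ ε₂), by positivity, fun ε hε hlt => ?_⟩
  simp only [lt_min_iff] at hlt
  obtain ⟨⟨hlt1, hltδ⟩, hltε₁, hltε₂⟩ := hlt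
  refine ⟨fun hk => ?_, fun hk => ?_⟩
  · refine (measureReal_mono (hsub ε hltδ)).trans ((H1 ε hε hltε₁ hk).trans ?_)
    exact mul_le_mul_of_nonneg_left
      (Real.rpow_le_rpow_of_exponent_ge hε hlt1.le (by linarith)) hC.le
  · refine subset_empty_iff.1 ((hsub ε hltδ).trans ?_)
    rw [← H2 hk]
    exact ambiguousSet_mono hltε₂.le le_rfl
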